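/- Two servers in series process updates for a monitor. Server 1 executes step 1 and takes independent exponential times of rate $\mu_1>0$; it generates a fresh (age zero) update immediately upon completing the previous one and passes the completed one to server 2. Server 2 executes step 2 and takes independent exponential times of rate $\mu_2>0$, independent of those of server 1, and delivers to the monitor. In the M/M/1/1 model server 2 blocks and discards every update that arrives from server 1 while it is busy. Let $\rho=\mu_1/\mu_2$, and let $\alpha$ be a real number. The age at the monitor at time $t$ is $t$ minus the generation time of the freshest update it has received by then, and the average age is the limit of the expected age as $t\to\infty$. Then, from every initial state (server 2 idle or busy, with ages $0\le x_1\le x_2\le x_0$ of the updates at server 1, server 2 and the monitor), the average age of the M/M/1/1 model exists and equals $$\Delta_{\mathrm{M/M/1/1}}(\mu_2,\rho)=\frac{2}{\mu_2}\Bigl(1+\frac1\rho\Bigr).$$ This is twice the average age $\Delta_{\mathrm{M/M/1}^*}(\mu_2,\rho)$ of the M/M/1* line network with preemption in service at both servers, in which server 1 always works on a current sample of the source, so that updates have age zero when they reach server 2 (at the times of a Poisson process of rate $\mu_1$), and in which an arrival at server 2 preempts and discards the update in service there. Moreover the discrete state $q(t)\in\{0,1\}$ of the M/M/1/1 model (server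 2 idle or busy) has exactly one stationary distribution $\pi$, and its power-weighted processor activity $\bar N(\rho)=\rho^\alpha\sum_q\pi_q n_{q,1}+\sum_q\pi_q n_{q,2}$, where $n_{q,i}$ is the number of processors that execute step $i$ in state $q$ (so $n_{0,1}=n_{1,1}=1$, $n_{0,2}=0$, $n_{1,2}=1$), is $$\bar N(\rho)=\rho^\alpha+\frac{\rho}{1+\rho}.$$ -/

import Mathlib

open MeasureTheory ProbabilityTheory Filter Topology

/-! Two servers in series: server 1 executes step 1 and passes its updates on to server 2, which
executes step 2 and delivers to the monitor. Sample paths are described through two real sequences: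
`x i` is the time that the `i`-th execution of step 1 takes (`i = 0, 1, …`, one after the other, server
1 never rests; `x 0` is what remains at time `0`), and `s k` is the time that step 2 of update `k`
takes. Update `0` is the one found at server 2 at time `0`, if there is one; update `k + 1` is the
one that leaves server 1 when execution number `k` ends. -/

namespace Tandem

/-- The discrete state: `0` if server 2 is idle, `1` if it is busy. -/
abbrev ServerState := Fin 2

/-- The situation at time `0`: the discrete state, the age at the monitor, and the ages of the
updates at servers 1 and 2 (the last one means nothing if server 2 is idle). -/
structure Start where
  state : ServerState
  monitorAge : ℝ
  age₁ : ℝ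
  age₂ : ℝ
  age₁_nonneg : 0 ≤ age₁
  age₁_le_age₂ : age₁ ≤ age₂
  age₂_le_monitorAge : age₂ ≤ monitorAge

/-- The time at which update `k` reaches server 2 (time `0` for update `0`). -/
def arrivalTime (x : ℕ → ℝ) (k : ℕ) : ℝ := ∑ i ∈ Finset.range k, x i

/-- Generate-at-will with zero wait: the time at which update `k` was generated. Server 1 generates a
fresh update at the moment it completes the previous one. -/
def genTime (I : Start) (x : ℕ → ℝ) : ℕ → ℝ
  | 0 => -I.age₂
  | 1 => -I.age₁
  | k + 2 => arrivalTime x (k + 1)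

/-- The age at the monitor at time `t`: the time elapsed since the generation of the freshest update
received so far, the monitor having held an update of age `a₀` at time `0`. Here `gen k` is the time at
which update `k` was generated, and `delivered k` says that it has reached the monitor by time `t`. -/
noncomputable def monitorAge (a₀ : ℝ) (gen : ℕ → ℝ) (delivered : ℕ → Prop) (t : ℝ) : ℝ :=
  t - sSup (insert (-a₀) (gen '' {k | delivered k}))

/-! ### M/M/1/1: server 2 blocks and discards while it is busy -/

/-- The time at which server 2 is finished with whatever it accepted among the updates `0, …, k`. -/
noncomputable def freeTime (q₀ : ServerState) (x s : ℕ → ℝ) : ℕ → ℝ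
  | 0 => if q₀ = 1 then s 0 else 0
  | k + 1 =>
    if freeTime q₀ x s k ≤ arrivalTime x (k + 1) then arrivalTime x (k + 1) + s (k + 1)
    else freeTime q₀ x s k

/-- Update `k + 1` is accepted if server 2 is idle when it arrives, and discarded otherwise. -/
def Accepted (q₀ : ServerState) (x s : ℕ → ℝ) : ℕ → Prop
  | 0 => q₀ = 1
  | k + 1 => freeTime q₀ x s k ≤ arrivalTime x (k + 1)

open Classical in
/-- The discrete state `q(t)`. -/
noncomputable def stateMM11 (q₀ : ServerState) (x s : ℕ → ℝ) (t : ℝ) : ServerState :=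
  if ∃ k, Accepted q₀ x s k ∧ arrivalTime x k ≤ t ∧ t < arrivalTime x k + s k then 1 else 0

/-- The age at the monitor in the M/M/1/1 model. -/
noncomputable def ageMM11 (I : Start) (x s : ℕ → ℝ) (t : ℝ) : ℝ :=
  monitorAge I.monitorAge (genTime I x)
    (fun k => Accepted I.state x s k ∧ arrivalTime x k + s k ≤ t) t

/-! ### M/M/1*: the line network with preemption in service -/

/-- Update `k` enters service as soon as it reaches server 2. -/
def Enters (q₀ : ServerState) : ℕ → Prop
  | 0 => q₀ = 1
  | _ + 1 => True

/-- Server 1 always works on a current sample of the source (a fresher sample preempts the one in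
service), so that an update has age zero when it is handed over to server 2. -/
def lineGenTime (I : Start) (x : ℕ → ℝ) : ℕ → ℝ
  | 0 => -I.age₂
  | k + 1 => arrivalTime x (k + 1)

/-- The age at the monitor in the M/M/1* line network: an update reaches the monitor if its service at
server 2 ends before the next update arrives there and preempts it. -/
noncomputable def ageMM1Star (I : Start) (x s : ℕ → ℝ) (t : ℝ) : ℝ :=
  monitorAge I.monitorAge (lineGenTime I x)
    (fun k => Enters I.state k ∧ arrivalTime x k + s k ≤ arrivalTime x (k + 1) ∧
      arrivalTime x k + s k ≤ t) t

/-! ### Averages -/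

variable {Ω : Type*} [MeasurableSpace Ω]

/-- The execution times are independent, exponential of rate `μ₁` for step 1 and `μ₂` for step 2. -/
structure ExpServices (P : Measure Ω) (μ₁ μ₂ : ℝ) (X S : ℕ → Ω → ℝ) : Prop where
  law_step₁ : ∀ i, HasLaw (X i) (expMeasure μ₁) P
  law_step₂ : ∀ k, HasLaw (S k) (expMeasure μ₂) P
  indep : iIndepFun (Sum.elim X S) P

/-- `a` is the average age of the age process `Δ`: the limit of `E[Δ(t)]` as `t → ∞`. -/
def IsAverageAge (P : Measure Ω) (Δ : ℝ → Ω → ℝ) (a : ℝ) : Prop :=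
  (∀ t, 0 ≤ t → Integrable (Δ t) P) ∧ Tendsto (fun t => ∫ ω, Δ t ω ∂P) atTop (𝓝 a)

/-- The transition probabilities `P(q(t) = j | q(0) = i)` of the discrete state of M/M/1/1. -/
noncomputable def transProb (P : Measure Ω) (X S : ℕ → Ω → ℝ) (t : ℝ) (i j : ServerState) : ℝ :=
  P.real {ω | stateMM11 i (fun n => X n ω) (fun n => S n ω) t = j}

/-- `π` is a stationary distribution for the transition probabilities `p t i j`. -/
def IsStationary (p : ℝ → ServerState → ServerState → ℝ) (π : ServerState → ℝ) : Prop :=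
  (∀ q, 0 ≤ π q) ∧ ∑ q, π q = 1 ∧ ∀ t, 0 ≤ t → ∀ j, ∑ i, π i * p t i j = π j

/-- The number `n_{q,1}` of processors executing step 1 in state `q`: server 1 never rests. -/
def numStep₁ (_q : ServerState) : ℝ := 1

/-- The number `n_{q,2}` of processors executing step 2 in state `q`. -/
def numStep₂ (q : ServerState) : ℝ := if q = 1 then 1 else 0

/-- The power-weighted processor activity `ρ^α N̄₁ + N̄₂`, where `N̄ᵢ = ∑ π_q n_{q,i}`. -/
noncomputable def activity (α ρ : ℝ) (π : ServerState → ℝ) : ℝ :=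
  ρ ^ α * (∑ q, π q * numStep₁ q) + ∑ q, π q * numStep₂ q

end Tandem

/-!
The age at time `t` is at least `a` exactly when no update generated after `t - a` has been
delivered by time `t`. Server 1 never rests, so arrivals at server 2 form a Poisson process. At
each of them the system starts afresh: under preemption because the arrival takes over server 2,
under blocking because the remaining execution time of the update in service is exponential
again. The probability that no update generated after time `u` is delivered by time `u + a`
therefore satisfies a renewal equation in `u`, whose only bounded solution is constant in `u`.
So the stationary age is distributed as `Y + D`, where `Y` is the time until the next arrival
and `D` the delay from that arrival until the first delivery of an update generated at it or
later. Conditioning `D` on whether server 2 becomes free before the following arrival gives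
`E D = 1 / μ₂` under preemption and `E D = 1 / μ₁ + 2 / μ₂` under blocking. The probability that
server 2 is busy at time `t` solves a renewal equation of the same kind, whose explicit solution
determines the stationary distribution.
-/

namespace Tandem

/-! ### Exponential laws -/

section Exponential

variable {r : ℝ}

lemma lintegral_expMeasure (f : ℝ → ENNReal) :
    ∫⁻ y, f y ∂(expMeasure r) =
      ∫⁻ y in Set.Ioi 0, ENNReal.ofReal (r * Real.exp (-(r * y))) * f y := by
  have hdensity : expMeasure r = volume.withDensity (exponentialPDF r) := rfl
  rw [hdensity, lintegral_withDensity_eq_lintegral_mul_non_measurable _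
      (show Measurable (exponentialPDF r) from (measurable_exponentialPDFReal r).ennreal_ofReal)
      (ae_of_all _ fun y => by simp [exponentialPDF]),
    ← setLIntegral_eq_of_support_subset (s := Set.Ici 0), restrict_Ioi_eq_restrict_Ici]
  · refine setLIntegral_congr_fun measurableSet_Ici fun y hy => ?_
    simp [exponentialPDF_of_nonneg hy]
  · intro y
    contrapose!
    intro hy
    simp [exponentialPDF_of_neg (not_le.1 hy)]

lemma expMeasure_Iic (hr : 0 < r) {t : ℝ} (ht : 0 ≤ t) :
    expMeasure r (Set.Iic t) = ENNReal.ofReal (1 - Real.exp (-(r * t))) := by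
  have := isProbabilityMeasure_expMeasure hr
  rw [← ofReal_cdf, cdf_expMeasure_eq hr, if_pos ht]

lemma expMeasure_Ioi (hr : 0 < r) {t : ℝ} (ht : 0 ≤ t) :
    expMeasure r (Set.Ioi t) = ENNReal.ofReal (Real.exp (-(r * t))) := by
  have := isProbabilityMeasure_expMeasure hr
  have hexp : Real.exp (-(r * t)) ≤ 1 := Real.exp_le_one_iff.2 (by nlinarith)
  rw [← Set.compl_Iic, prob_compl_eq_one_sub measurableSet_Iic, expMeasure_Iic hr ht,
    ← ENNReal.ofReal_one, ← ENNReal.ofReal_sub _ (sub_nonneg.2 hexp), sub_sub_cancel]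

lemma ae_expMeasure_nonneg (hr : 0 < r) : ∀ᵐ y ∂(expMeasure r), 0 ≤ y := by
  have hpos : ∀ᵐ y ∂(expMeasure r), 0 < y := by
    simpa [ae_iff, Set.Iic] using expMeasure_Iic hr le_rfl
  exact hpos.mono fun _ => le_of_lt

lemma expMeasure_Iic_lt_one (hr : 0 < r) {t : ℝ} (ht : 0 ≤ t) : expMeasure r (Set.Iic t) < 1 := by
  rw [expMeasure_Iic hr ht, ENNReal.ofReal_lt_one]
  linarith [Real.exp_pos (-(r * t))]

lemma setLIntegral_Ioi_sub_expMeasure {y : ℝ} (hy : 0 ≤ y) (G : ℝ → ENNReal) :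
    ∫⁻ v in Set.Ioi y, G (v - y) ∂(expMeasure r) =
      ENNReal.ofReal (Real.exp (-(r * y))) * ∫⁻ v, G v ∂(expMeasure r) := by
  have hpre : (fun v : ℝ => v - y) ⁻¹' Set.Ioi 0 = Set.Ioi y := by ext; simp
  have hind : ∀ v, (Set.Ioi y).indicator (fun v => G (v - y)) v =
      (Set.Ioi 0).indicator G (v - y) := fun v => by
    rw [← hpre]; rfl
  rw [← lintegral_indicator measurableSet_Ioi, lintegral_expMeasure, lintegral_expMeasure]
  simp only [hind]
  rw [← lintegral_indicator measurableSet_Ioi, ← lintegral_add_right_eq_self _ y,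
    ← lintegral_const_mul' _ _ ENNReal.ofReal_ne_top, ← lintegral_indicator measurableSet_Ioi]
  refine lintegral_congr fun v => ?_
  by_cases hv : 0 < v
  · have hvy : 0 < v + y := by linarith
    simp only [Set.indicator, Set.mem_Ioi, hv, hvy, if_true, add_sub_cancel_right, ← mul_assoc]
    rw [← ENNReal.ofReal_mul (Real.exp_pos _).le, mul_left_comm, ← Real.exp_add]
    ring_nf
  · simp [Set.indicator, hv]

lemma lintegral_Ioi_ofReal_exp {c : ℝ} (hc : 0 < c) :
    ∫⁻ y in Set.Ioi (0 : ℝ), ENNReal.ofReal (Real.exp (-(c * y))) = ENNReal.ofReal (1 / c) := by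
  simp only [← neg_mul]
  rw [← ofReal_integral_eq_lintegral_ofReal (exp_neg_integrableOn_Ioi 0 hc)
      (ae_of_all _ fun y => (Real.exp_pos _).le),
    integral_exp_mul_Ioi (neg_lt_zero.2 hc) 0]
  simp

lemma lintegral_expMeasure_ofReal_exp (hr : 0 < r) {c : ℝ} (hc : 0 ≤ c) :
    ∫⁻ y, ENNReal.ofReal (Real.exp (-(c * y))) ∂(expMeasure r) =
      ENNReal.ofReal (r / (r + c)) := by
  have hmul : ∀ y : ℝ, ENNReal.ofReal (r * Real.exp (-(r * y))) *
      ENNReal.ofReal (Real.exp (-(c * y))) =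
      ENNReal.ofReal r * ENNReal.ofReal (Real.exp (-((r + c) * y))) := fun y => by
    rw [← ENNReal.ofReal_mul (by positivity), ← ENNReal.ofReal_mul hr.le, mul_assoc,
      ← Real.exp_add]
    ring_nf
  rw [lintegral_expMeasure]
  simp only [hmul]
  rw [lintegral_const_mul' _ _ ENNReal.ofReal_ne_top, lintegral_Ioi_ofReal_exp (by linarith),
    ← ENNReal.ofReal_mul hr.le, mul_one_div]

lemma setLIntegral_Iic_ofReal_expMeasure (hr : 0 ≤ r) {t : ℝ} (ht : 0 ≤ t) {f : ℝ → ℝ}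
    (hf : Continuous f) (hf0 : ∀ y ≤ t, 0 ≤ f y) :
    ∫⁻ y in Set.Iic t, ENNReal.ofReal (f y) ∂(expMeasure r) =
      ENNReal.ofReal (∫ y in (0)..t, r * Real.exp (-(r * y)) * f y) := by
  have hcont : Continuous fun y => r * Real.exp (-(r * y)) * f y := by fun_prop
  rw [intervalIntegral.integral_of_le ht, ofReal_integral_eq_lintegral_ofReal
      ((hcont.integrableOn_Icc (a := 0) (b := t)).mono_set Set.Ioc_subset_Icc_self)
      ((ae_restrict_mem measurableSet_Ioc).mono fun y hy =>
        mul_nonneg (by positivity) (hf0 y hy.2)),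
    ← lintegral_indicator measurableSet_Iic, lintegral_expMeasure, ← Set.Ioi_inter_Iic,
    Set.inter_comm, ← Measure.restrict_restrict measurableSet_Iic,
    ← lintegral_indicator measurableSet_Iic]
  refine lintegral_congr fun y => ?_
  by_cases hy : y ≤ t
  · simp only [Set.indicator, Set.mem_Iic, hy, if_true]
    rw [← ENNReal.ofReal_mul (by positivity)]
  · simp [hy]

lemma lintegral_of_exponential_tail {Ω : Type*} [MeasurableSpace Ω] {P : Measure Ω} {Y : Ω → ℝ}
    {c : ℝ} (hc : 0 < c) (hY : AEMeasurable Y P) (hY0 : 0 ≤ᵐ[P] Y)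
    (htail : ∀ t, 0 < t → P {ω | t < Y ω} = ENNReal.ofReal (Real.exp (-(c * t)))) :
    ∫⁻ ω, ENNReal.ofReal (Y ω) ∂P = ENNReal.ofReal (1 / c) := by
  rw [lintegral_eq_lintegral_meas_lt P hY0 hY, ← lintegral_Ioi_ofReal_exp hc]
  exact setLIntegral_congr_fun measurableSet_Ioi htail

lemma lintegral_ofReal_expMeasure (hr : 0 < r) :
    ∫⁻ y, ENNReal.ofReal y ∂(expMeasure r) = ENNReal.ofReal (1 / r) :=
  lintegral_of_exponential_tail hr aemeasurable_id (ae_expMeasure_nonneg hr)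
    fun _ ht => expMeasure_Ioi hr ht.le

end Exponential

/-! ### Renewal and regeneration -/

lemma renewal_unique {ν : Measure ℝ} (hν0 : ∀ᵐ y ∂ν, 0 ≤ y) (hν1 : ∀ t, 0 ≤ t → ν (Set.Iic t) < 1)
    {φ ψ g : ℝ → ENNReal} (hφ1 : ∀ t, 0 ≤ t → φ t ≤ 1) (hψ1 : ∀ t, 0 ≤ t → ψ t ≤ 1)
    (hφ : ∀ t, 0 ≤ t → φ t = g t + ∫⁻ y in Set.Iic t, φ (t - y) ∂ν)
    (hψ : ∀ t, 0 ≤ t → ψ t = g t + ∫⁻ y in Set.Iic t, ψ (t - y) ∂ν) {t : ℝ} (ht : 0 ≤ t) :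
    φ t = ψ t := by
  wlog hle : ∀ φ ψ : ℝ → ENNReal, (∀ t, 0 ≤ t → φ t ≤ 1) →
      (∀ t, 0 ≤ t → φ t = g t + ∫⁻ y in Set.Iic t, φ (t - y) ∂ν) →
      (∀ t, 0 ≤ t → ψ t = g t + ∫⁻ y in Set.Iic t, ψ (t - y) ∂ν) → φ t ≤ ψ t
  · refine this hν0 hν1 hφ1 hψ1 hφ hψ ht fun φ ψ hφ1 hφ hψ => ?_
    -- The convolution contracts by `ν (Iic t) < 1` on `[0, t]`.
    set θ := ν (Set.Iic t)
    have hiter : ∀ n : ℕ, ∀ u ∈ Set.Icc 0 t, φ u ≤ ψ u + θ ^ n := by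
      intro n
      induction n with
      | zero => exact fun u hu => by simpa using (hφ1 u hu.1).trans le_add_self
      | succ n ih =>
        intro u hu
        rw [hφ u hu.1, hψ u hu.1, add_assoc]
        gcongr
        calc ∫⁻ y in Set.Iic u, φ (u - y) ∂ν
            ≤ ∫⁻ y in Set.Iic u, (ψ (u - y) + θ ^ n) ∂ν := by
              refine lintegral_mono_ae ?_
              filter_upwards [ae_restrict_of_ae hν0, ae_restrict_mem measurableSet_Iic]
                with y hy hyu
              exact ih _ ⟨sub_nonneg.2 hyu, by linarith [hu.2]⟩
          _ = ∫⁻ y in Set.Iic u, ψ (u - y) ∂ν + θ ^ n * ν (Set.Iic u) := by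
              rw [lintegral_add_right _ measurable_const, setLIntegral_const]
          _ ≤ ∫⁻ y in Set.Iic u, ψ (u - y) ∂ν + θ ^ (n + 1) := by
              rw [pow_succ]
              gcongr
              exact measure_mono (Set.Iic_subset_Iic.2 hu.2)
    have hlim : Tendsto (fun n : ℕ => ψ t + θ ^ n) atTop (𝓝 (ψ t + 0)) :=
      (ENNReal.tendsto_pow_atTop_nhds_zero_of_lt_one (hν1 t ht)).const_add _
    rw [add_zero] at hlim
    exact ge_of_tendsto' hlim fun n => hiter n t ⟨ht, le_rfl⟩
  exact le_antisymm (hle φ ψ hφ1 hφ hψ) (hle ψ φ hψ1 hψ hφ)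

section Regeneration

variable {Ω : Type*} [MeasurableSpace Ω] {Q : Measure Ω} [IsProbabilityMeasure Q] {T : Ω → Ω}
  {E : Set Ω} {C D : Ω → ENNReal}

lemma lintegral_ne_top_of_regeneration (hE : MeasurableSet E) (hC : Measurable C)
    (hD : Measurable D)
    (hT : ∀ f : Ω → ENNReal, Measurable f → ∫⁻ ω in E, f (T ω) ∂Q = Q E * ∫⁻ ω, f ω ∂Q)
    (hCD : ∀ᵐ ω ∂Q, D ω = C ω + E.indicator (fun ω => D (T ω)) ω)
    (hE1 : Q Eᶜ ≠ 0) (hC1 : ∫⁻ ω, C ω ∂Q ≠ ⊤) : ∫⁻ ω, D ω ∂Q ≠ ⊤ := by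
  have htrunc : ∀ M : ℕ, ∫⁻ ω, D ω ⊓ M ∂Q ≤ (∫⁻ ω, C ω ∂Q) / Q Eᶜ := by
    intro M
    have hfin : Q E * ∫⁻ ω, D ω ⊓ M ∂Q ≠ ⊤ := ENNReal.mul_ne_top (measure_ne_top _ _)
      (ne_top_of_le_ne_top (by simp) (lintegral_mono fun ω => (inf_le_right : D ω ⊓ M ≤ M)))
    rw [ENNReal.le_div_iff_mul_le (.inl hE1) (.inl (measure_ne_top _ _)), mul_comm,
      ← ENNReal.add_le_add_iff_right hfin, ← add_mul, add_comm (Q Eᶜ),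
      measure_add_measure_compl hE, measure_univ, one_mul,
      ← hT (fun ω => D ω ⊓ M) (hD.inf measurable_const),
      ← lintegral_indicator hE, ← lintegral_add_left hC]
    refine lintegral_mono_ae (hCD.mono fun ω hω => ?_)
    rw [hω]
    by_cases hωE : ω ∈ E
    · simpa [hωE] using (inf_le_inf_left _ le_add_self).trans (min_add_add_left ..).le
    · simp [hωE]
  have hsup : ∀ ω, D ω = ⨆ M : ℕ, D ω ⊓ M := fun ω => by
    rw [← inf_iSup_eq, ENNReal.iSup_natCast, inf_top_eq]
  rw [lintegral_congr hsup,
    lintegral_iSup (f := fun (M : ℕ) ω => D ω ⊓ M) (fun M => hD.inf measurable_const)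
    fun M N hMN ω => inf_le_inf_left _ (Nat.cast_le.2 hMN)]
  exact ne_top_of_le_ne_top (ENNReal.div_ne_top hC1 hE1) (iSup_le htrunc)

lemma measure_compl_mul_lintegral_of_regeneration (hE : MeasurableSet E) (hC : Measurable C)
    (hD : Measurable D)
    (hT : ∀ f : Ω → ENNReal, Measurable f → ∫⁻ ω in E, f (T ω) ∂Q = Q E * ∫⁻ ω, f ω ∂Q)
    (hCD : ∀ᵐ ω ∂Q, D ω = C ω + E.indicator (fun ω => D (T ω)) ω)
    (hE1 : Q Eᶜ ≠ 0) (hC1 : ∫⁻ ω, C ω ∂Q ≠ ⊤) :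
    Q Eᶜ * ∫⁻ ω, D ω ∂Q = ∫⁻ ω, C ω ∂Q := by
  have hfin : Q E * ∫⁻ ω, D ω ∂Q ≠ ⊤ := ENNReal.mul_ne_top (measure_ne_top _ _)
    (lintegral_ne_top_of_regeneration hE hC hD hT hCD hE1 hC1)
  rw [← ENNReal.add_left_inj hfin]
  calc Q Eᶜ * ∫⁻ ω, D ω ∂Q + Q E * ∫⁻ ω, D ω ∂Q
      = ∫⁻ ω, D ω ∂Q := by
        rw [← add_mul, add_comm, measure_add_measure_compl hE, measure_univ, one_mul]
    _ = ∫⁻ ω, C ω ∂Q + Q E * ∫⁻ ω, D ω ∂Q := by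
        rw [← hT D hD, ← lintegral_indicator hE, ← lintegral_add_left hC, lintegral_congr_ae hCD]

end Regeneration

lemma volume_Ioi_inter_sub_preimage {A : Set ℝ} (hA : MeasurableSet A) (hneg : Set.Iio 0 ⊆ A)
    {y : ℝ} (hy : 0 ≤ y) :
    volume (Set.Ioi 0 ∩ (fun t => t - y) ⁻¹' A) = ENNReal.ofReal y + volume (Set.Ioi 0 ∩ A) := by
  have hshift : Set.Ioi 0 ∩ (fun t => t - y) ⁻¹' A =
      (fun t => t - y) ⁻¹' (Set.Ioi (-y) ∩ A) := by ext; simp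
  have hunion : Set.Ioi (-y) ∩ A = Set.Ioc (-y) 0 ∩ A ∪ Set.Ioi 0 ∩ A := by
    rw [← Set.union_inter_distrib_right, Set.Ioc_union_Ioi_eq_Ioi (by linarith)]
  have hIoo : Set.Ioo (-y) 0 ∩ A = Set.Ioo (-y) 0 := Set.inter_eq_left.2 fun t ht => hneg ht.2
  rw [hshift, (measurePreserving_sub_right volume y).measure_preimage
      (measurableSet_Ioi.inter hA).nullMeasurableSet, hunion,
    measure_union (Set.Ioc_disjoint_Ioi_same.mono Set.inter_subset_left Set.inter_subset_left)
      (measurableSet_Ioi.inter hA),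
    measure_congr (Ioo_ae_eq_Ioc.symm.inter (ae_eq_refl A)), hIoo]
  simp

/-! ### Sample paths -/

section InfiniteProduct

variable {ι : Type*} {α : ι → Type*} [∀ i, MeasurableSpace (α i)] {m : ∀ i, Measure (α i)}
  [∀ i, IsProbabilityMeasure (m i)]

lemma comap_precomp_le_iSup {κ : Type*} (g : κ → ι) :
    MeasurableSpace.comap (fun (w : ∀ i, α i) k => w (g k)) MeasurableSpace.pi ≤
      ⨆ i ∈ Set.range g, MeasurableSpace.comap (fun w : ∀ i, α i => w i) inferInstance := by
  rw [MeasurableSpace.pi, MeasurableSpace.comap_iSup]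
  refine iSup_le fun k => ?_
  rw [MeasurableSpace.comap_comp]
  exact le_iSup₂_of_le (g k) ⟨k, rfl⟩ le_rfl

lemma indepFun_infinitePi_of_disjoint_range {κ κ' : Type*} {g : κ → ι} {h : κ' → ι}
    (hgh : Disjoint (Set.range g) (Set.range h)) :
    IndepFun (fun (w : ∀ i, α i) k => w (g k)) (fun w k => w (h k)) (Measure.infinitePi m) := by
  have hcoord : iIndepFun (fun i (w : ∀ i, α i) => w i) (Measure.infinitePi m) :=
    iIndepFun_infinitePi (X := fun _ a => a) fun _ => measurable_id
  exact indep_of_indep_of_le_left (indep_of_indep_of_le_right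
    (indep_iSup_of_disjoint (fun i => (measurable_pi_apply i).comap_le) hcoord hgh)
    (comap_precomp_le_iSup h)) (comap_precomp_le_iSup g)

lemma infinitePi_prod_map_update [DecidableEq ι] (i : ι) :
    ((Measure.infinitePi m).prod (m i)).map (fun p => Function.update p.1 i p.2) =
      Measure.infinitePi m := by
  refine Measure.eq_infinitePi m fun s t ht => ?_
  have hpre : (fun p : (∀ i, α i) × α i => Function.update p.1 i p.2) ⁻¹' (s : Set ι).pi t =
      (↑(s.erase i) : Set ι).pi t ×ˢ (if i ∈ s then t i else Set.univ) := by
    ext ⟨w, a⟩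
    split_ifs with hi
    · simp only [Set.mem_preimage, Set.mem_pi, Set.mem_prod, Finset.mem_coe, Finset.mem_erase]
      refine ⟨fun h => ⟨fun j hj => by simpa [hj.1] using h j hj.2, by simpa using h i hi⟩, ?_⟩
      rintro ⟨hw, ha⟩ j hj
      by_cases hji : j = i
      · subst hji; simpa using ha
      · simpa [hji] using hw j ⟨hji, hj⟩
    · have hne : ∀ j ∈ s, j ≠ i := fun j hj hji => hi (hji ▸ hj)
      simp +contextual [Set.mem_pi, Finset.erase_eq_of_notMem hi, hne]
  rw [Measure.map_apply (by fun_prop) (.pi s.countable_toSet fun i _ => ht i), hpre,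
    Measure.prod_prod, Measure.infinitePi_pi _ fun i _ => ht i]
  split_ifs with hi
  · exact Finset.prod_erase_mul s _ hi
  · rw [measure_univ, mul_one, Finset.erase_eq_of_notMem hi]

end InfiniteProduct

/-- A sample path of the execution times: `z (.inl i)` is the length of execution `i` of step 1, and
`z (.inr k)` the length of step 2 of update `k`. -/
abbrev SamplePath := ℕ ⊕ ℕ → ℝ

namespace SamplePath

/-- The execution times of step 1. -/
def x (z : SamplePath) (i : ℕ) : ℝ := z (.inl i)

/-- The execution times of step 2. -/
def s (z : SamplePath) (k : ℕ) : ℝ := z (.inr k)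

/-- The sample path without the first execution time of either step. -/
def tail (z : SamplePath) : SamplePath := fun i => z (i.map Nat.succ Nat.succ)

@[fun_prop]
lemma measurable_tail : Measurable tail := by
  unfold tail
  fun_prop

@[fun_prop]
lemma measurable_x : Measurable x := by
  unfold x
  fun_prop

@[fun_prop]
lemma measurable_s : Measurable s := by
  unfold s
  fun_prop

lemma measurableSet_lt : MeasurableSet {z : SamplePath | z.x 0 < z.s 0} :=
  _root_.measurableSet_lt (by fun_prop) (by fun_prop)

end SamplePath

instance {ι κ α : Type*} [MeasurableSpace α] (m : ι → Measure α) (m' : κ → Measure α)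
    [∀ i, IsProbabilityMeasure (m i)] [∀ k, IsProbabilityMeasure (m' k)] (i : ι ⊕ κ) :
    IsProbabilityMeasure (Sum.elim m m' i) := by
  cases i <;> dsimp only [Sum.elim_inl, Sum.elim_inr] <;> infer_instance

/-- The law of the sample path when all execution times are independent, those of step 1 having law
`ν₁` and those of step 2 law `ν₂`. -/
noncomputable def pathMeasure (ν₁ ν₂ : Measure ℝ) : Measure SamplePath :=
  Measure.infinitePi (Sum.elim (fun _ => ν₁) fun _ => ν₂)

section PathMeasure

variable {ν₁ ν₂ : Measure ℝ} [IsProbabilityMeasure ν₁] [IsProbabilityMeasure ν₂]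

instance : IsProbabilityMeasure (pathMeasure ν₁ ν₂) := by
  unfold pathMeasure
  infer_instance

lemma ExpServices.hasLaw_pathMeasure {Ω : Type*} [MeasurableSpace Ω] {P : Measure Ω} {μ₁ μ₂ : ℝ}
    (hμ₁ : 0 < μ₁) (hμ₂ : 0 < μ₂) {X S : ℕ → Ω → ℝ} (h : ExpServices P μ₁ μ₂ X S) :
    HasLaw (fun ω i => Sum.elim X S i ω) (pathMeasure (expMeasure μ₁) (expMeasure μ₂)) P := by
  have := isProbabilityMeasure_expMeasure hμ₁
  have := isProbabilityMeasure_expMeasure hμ₂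
  have hlaw : ∀ i, HasLaw (Sum.elim X S i)
      (Sum.elim (fun _ : ℕ => expMeasure μ₁) (fun _ : ℕ => expMeasure μ₂) i) P := by
    rintro (i | k)
    exacts [h.law_step₁ i, h.law_step₂ k]
  exact h.indep.hasLaw_infinitePi hlaw (aemeasurable_pi_iff.2 fun i => (hlaw i).aemeasurable)

lemma hasLaw_x (k : ℕ) : HasLaw (fun z : SamplePath => z.x k) ν₁ (pathMeasure ν₁ ν₂) :=
  ⟨by fun_prop, Measure.infinitePi_map_eval _ (Sum.inl k : ℕ ⊕ ℕ)⟩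

lemma hasLaw_s (k : ℕ) : HasLaw (fun z : SamplePath => z.s k) ν₂ (pathMeasure ν₁ ν₂) :=
  ⟨by fun_prop, Measure.infinitePi_map_eval _ (Sum.inr k : ℕ ⊕ ℕ)⟩

lemma hasLaw_tail : HasLaw SamplePath.tail (pathMeasure ν₁ ν₂) (pathMeasure ν₁ ν₂) := by
  refine ⟨SamplePath.measurable_tail.aemeasurable, ?_⟩
  have hinj : Function.Injective (Sum.map Nat.succ Nat.succ) :=
    Nat.succ_injective.sumMap Nat.succ_injective
  refine (Measure.map_infinitePi_infinitePi_of_inj hinj).trans ?_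
  unfold pathMeasure
  congr 1
  funext i
  cases i <;> rfl

lemma hasLaw_head : HasLaw (fun z : SamplePath => (z.x 0, z.s 0)) (ν₁.prod ν₂)
    (pathMeasure ν₁ ν₂) := by
  have hindep : IndepFun (fun z : SamplePath => z.x 0) (fun z => z.s 0) (pathMeasure ν₁ ν₂) :=
    (iIndepFun_infinitePi (X := fun _ a => a) fun _ => measurable_id).indepFun
      (i := Sum.inl 0) (j := Sum.inr 0) (by simp)
  refine ⟨by fun_prop, ?_⟩
  rw [(indepFun_iff_map_prod_eq_prod_map_map (by fun_prop) (by fun_prop)).1 hindep,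
    (hasLaw_x 0).map_eq, (hasLaw_s 0).map_eq]

lemma indepFun_head_tail :
    IndepFun (fun z : SamplePath => (z.x 0, z.s 0)) SamplePath.tail (pathMeasure ν₁ ν₂) := by
  have hdisj : Disjoint (Set.range (Sum.map (fun _ => 0) fun _ => 0 : Unit ⊕ Unit → ℕ ⊕ ℕ))
      (Set.range (Sum.map Nat.succ Nat.succ)) := by
    rw [Set.disjoint_left]
    rintro _ ⟨i, rfl⟩ ⟨j, hj⟩
    cases i <;> cases j <;> simp at hj
  have hindep := indepFun_infinitePi_of_disjoint_range
    (m := Sum.elim (fun _ : ℕ => ν₁) fun _ : ℕ => ν₂) hdisj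
  exact hindep.comp (φ := fun w : Unit ⊕ Unit → ℝ => (w (.inl ()), w (.inr ())))
    (by fun_prop) measurable_id

lemma lintegral_pathMeasure_head_tail {f : ℝ × ℝ × SamplePath → ENNReal} (hf : Measurable f) :
    ∫⁻ z, f (z.x 0, z.s 0, z.tail) ∂(pathMeasure ν₁ ν₂) =
      ∫⁻ y, ∫⁻ v, ∫⁻ z, f (y, v, z) ∂(pathMeasure ν₁ ν₂) ∂ν₂ ∂ν₁ := by
  have hf' : Measurable fun p : (ℝ × ℝ) × SamplePath => f (p.1.1, p.1.2, p.2) := by fun_prop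
  have hmap : (pathMeasure ν₁ ν₂).map (fun z => ((z.x 0, z.s 0), z.tail)) =
      (ν₁.prod ν₂).prod (pathMeasure ν₁ ν₂) := by
    rw [(indepFun_iff_map_prod_eq_prod_map_map (by fun_prop) (by fun_prop)).1 indepFun_head_tail,
      hasLaw_head.map_eq, hasLaw_tail.map_eq]
  rw [← lintegral_map (g := fun z : SamplePath => ((z.x 0, z.s 0), z.tail)) hf' (by fun_prop),
    hmap, lintegral_prod _ hf'.aemeasurable,
    lintegral_prod _ hf'.lintegral_prod_right'.aemeasurable]

lemma lintegral_pathMeasure_update_s {f : SamplePath → ENNReal} (hf : Measurable f) (k : ℕ) :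
    ∫⁻ v, ∫⁻ z, f (Function.update z (.inr k) v) ∂(pathMeasure ν₁ ν₂) ∂ν₂ =
      ∫⁻ z, f z ∂(pathMeasure ν₁ ν₂) := by
  have hmap : ((pathMeasure ν₁ ν₂).prod ν₂).map (fun p => Function.update p.1 (.inr k) p.2) =
      pathMeasure ν₁ ν₂ :=
    infinitePi_prod_map_update (m := Sum.elim (fun _ : ℕ => ν₁) fun _ : ℕ => ν₂) (.inr k)
  have hupdate : Measurable fun p : SamplePath × ℝ => Function.update p.1 (.inr k) p.2 := by
    fun_prop
  conv_rhs => rw [← hmap, lintegral_map hf hupdate]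
  exact (lintegral_prod_symm' _ (hf.comp hupdate)).symm

end PathMeasure

namespace SamplePath

/-- All execution times are nonnegative. -/
def Nonneg (z : SamplePath) : Prop := (∀ i, 0 ≤ z.x i) ∧ ∀ k, 0 ≤ z.s k

lemma ae_nonneg {ν₁ ν₂ : Measure ℝ} [IsProbabilityMeasure ν₁] [IsProbabilityMeasure ν₂]
    (hν₁ : ∀ᵐ y ∂ν₁, 0 ≤ y) (hν₂ : ∀ᵐ v ∂ν₂, 0 ≤ v) :
    ∀ᵐ z ∂(pathMeasure ν₁ ν₂), z.Nonneg := by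
  have hx : ∀ i, ∀ᵐ z ∂(pathMeasure ν₁ ν₂), 0 ≤ z.x i := fun i =>
    ae_of_ae_map (hasLaw_x i).aemeasurable (by rwa [(hasLaw_x i).map_eq])
  have hs : ∀ k, ∀ᵐ z ∂(pathMeasure ν₁ ν₂), 0 ≤ z.s k := fun k =>
    ae_of_ae_map (hasLaw_s k).aemeasurable (by rwa [(hasLaw_s k).map_eq])
  filter_upwards [ae_all_iff.2 hx, ae_all_iff.2 hs] with z hzx hzs using ⟨hzx, hzs⟩

/-- The sample path seen from the first arrival at server 2 on, if server 2 blocks: the update in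
service at time `0` is either finished by then, or becomes update `0` with the remainder of its
execution time. -/
noncomputable def nextBlock (z : SamplePath) : SamplePath :=
  if z.s 0 ≤ z.x 0 then z.tail else Function.update z.tail (.inr 0) (z.s 0 - z.x 0)

@[fun_prop]
lemma measurable_nextBlock : Measurable nextBlock :=
  Measurable.ite (measurableSet_le (by fun_prop) (by fun_prop)) measurable_tail (by fun_prop)

lemma x_tail (z : SamplePath) (i : ℕ) : z.tail.x i = z.x (i + 1) := rfl

lemma s_tail (z : SamplePath) (k : ℕ) : z.tail.s k = z.s (k + 1) := rfl

lemma x_nextBlock (z : SamplePath) (i : ℕ) : z.nextBlock.x i = z.x (i + 1) := by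
  unfold nextBlock
  split_ifs <;> simp [x, tail]

lemma s_nextBlock_zero (z : SamplePath) :
    z.nextBlock.s 0 = if z.s 0 ≤ z.x 0 then z.s 1 else z.s 0 - z.x 0 := by
  unfold nextBlock
  split_ifs <;> simp [s, tail]

lemma s_nextBlock_succ (z : SamplePath) (k : ℕ) : z.nextBlock.s (k + 1) = z.s (k + 2) := by
  unfold nextBlock
  split_ifs <;> simp [s, tail]

end SamplePath

/-- The path `next z` seen from the first arrival at server 2 on has the law of `z` and is
independent of the time of that arrival and of whether server 2 is still busy then. -/
structure Regenerates (ν₁ ν₂ : Measure ℝ) (next : SamplePath → SamplePath) : Prop where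
  measurable : Measurable next
  lintegral_next : ∀ {H : ℝ × Prop × SamplePath → ENNReal}, Measurable H →
    ∫⁻ z, H (z.x 0, z.x 0 < z.s 0, next z) ∂(pathMeasure ν₁ ν₂) =
      ∫⁻ z, ∫⁻ z', H (z.x 0, z.x 0 < z.s 0, z') ∂(pathMeasure ν₁ ν₂) ∂(pathMeasure ν₁ ν₂)

section Regenerates

variable {ν₁ ν₂ : Measure ℝ} [IsProbabilityMeasure ν₁] [IsProbabilityMeasure ν₂]
  {next : SamplePath → SamplePath}

lemma measurable_fst_lt_fst_snd : Measurable fun p : ℝ × ℝ × SamplePath => p.1 < p.2.1 :=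
  measurableSet_setOfPred.1 (measurableSet_lt (by fun_prop) (by fun_prop))

lemma lintegral_lintegral_pathMeasure_head {H : ℝ × Prop × SamplePath → ENNReal}
    (hH : Measurable H) :
    ∫⁻ z, ∫⁻ z', H (z.x 0, z.x 0 < z.s 0, z') ∂(pathMeasure ν₁ ν₂) ∂(pathMeasure ν₁ ν₂) =
      ∫⁻ y, ∫⁻ v, ∫⁻ z, H (y, y < v, z) ∂(pathMeasure ν₁ ν₂) ∂ν₂ ∂ν₁ := by
  have := measurable_fst_lt_fst_snd
  have hf : Measurable fun p : ℝ × ℝ × SamplePath =>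
      ∫⁻ z', H (p.1, p.1 < p.2.1, z') ∂(pathMeasure ν₁ ν₂) :=
    Measurable.lintegral_prod_right' (f := fun q : (ℝ × ℝ × SamplePath) × SamplePath =>
      H (q.1.1, q.1.1 < q.1.2.1, q.2)) (by fun_prop)
  simpa using lintegral_pathMeasure_head_tail (ν₁ := ν₁) (ν₂ := ν₂) hf

lemma regenerates_tail : Regenerates ν₁ ν₂ SamplePath.tail where
  measurable := SamplePath.measurable_tail
  lintegral_next hH := by
    have := measurable_fst_lt_fst_snd
    rw [lintegral_lintegral_pathMeasure_head hH]
    exact lintegral_pathMeasure_head_tail (f := fun p => _) (hH.comp (by fun_prop :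
      Measurable fun p : ℝ × ℝ × SamplePath => (p.1, p.1 < p.2.1, p.2.2)))

lemma lintegral_nextBlock_of_nonneg {r : ℝ} (hr : 0 < r) {y : ℝ} (hy : 0 ≤ y)
    {f : Prop × SamplePath → ENNReal} (hf : Measurable f) :
    ∫⁻ v, ∫⁻ z, f (y < v, if v ≤ y then z else Function.update z (.inr 0) (v - y))
        ∂(pathMeasure ν₁ (expMeasure r)) ∂(expMeasure r) =
      ∫⁻ v, ∫⁻ z, f (y < v, z) ∂(pathMeasure ν₁ (expMeasure r)) ∂(expMeasure r) := by
  have := isProbabilityMeasure_expMeasure hr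
  rw [← lintegral_add_compl _ (measurableSet_Iic (a := y)),
    ← lintegral_add_compl (fun v => ∫⁻ z, f (y < v, z) ∂_) (measurableSet_Iic (a := y))]
  simp only [Set.compl_Iic]
  congr 1
  · exact setLIntegral_congr_fun measurableSet_Iic fun v hv => by simp [Set.mem_Iic.1 hv]
  · have hbusy : Measurable fun z : SamplePath => f (True, z) := by fun_prop
    calc ∫⁻ v in Set.Ioi y, ∫⁻ z, f (y < v, if v ≤ y then z else
            Function.update z (.inr 0) (v - y)) ∂(pathMeasure ν₁ (expMeasure r)) ∂(expMeasure r)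
        = ∫⁻ v in Set.Ioi y, ∫⁻ z, f (True, Function.update z (.inr 0) (v - y))
            ∂(pathMeasure ν₁ (expMeasure r)) ∂(expMeasure r) :=
          setLIntegral_congr_fun measurableSet_Ioi fun v hv => by
            simp [Set.mem_Ioi.1 hv, (Set.mem_Ioi.1 hv).not_ge]
      _ = expMeasure r (Set.Ioi y) *
            ∫⁻ z, f (True, z) ∂(pathMeasure ν₁ (expMeasure r)) := by
          rw [setLIntegral_Ioi_sub_expMeasure hy fun v => ∫⁻ z, f (True,
            Function.update z (.inr 0) v) ∂(pathMeasure ν₁ (expMeasure r)),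
            lintegral_pathMeasure_update_s hbusy, expMeasure_Ioi hr hy]
      _ = ∫⁻ v in Set.Ioi y, ∫⁻ z, f (y < v, z) ∂(pathMeasure ν₁ (expMeasure r))
            ∂(expMeasure r) := by
          rw [mul_comm, ← setLIntegral_const]
          exact setLIntegral_congr_fun measurableSet_Ioi fun v hv => by simp [Set.mem_Ioi.1 hv]

lemma regenerates_nextBlock {r : ℝ} (hr : 0 < r) (hν₁ : ∀ᵐ y ∂ν₁, 0 ≤ y) :
    Regenerates ν₁ (expMeasure r) SamplePath.nextBlock where
  measurable := SamplePath.measurable_nextBlock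
  lintegral_next {H} hH := by
    have := isProbabilityMeasure_expMeasure hr
    have := measurable_fst_lt_fst_snd
    have hnext : Measurable fun p : ℝ × ℝ × SamplePath =>
        if p.2.1 ≤ p.1 then p.2.2 else Function.update p.2.2 (.inr 0) (p.2.1 - p.1) :=
      Measurable.ite (measurableSet_le (by fun_prop) (by fun_prop)) (by fun_prop) (by fun_prop)
    rw [lintegral_lintegral_pathMeasure_head hH]
    refine (lintegral_pathMeasure_head_tail (f := fun p => H (p.1, p.1 < p.2.1,
      if p.2.1 ≤ p.1 then p.2.2 else Function.update p.2.2 (.inr 0) (p.2.1 - p.1)))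
      (by fun_prop)).trans ?_
    refine lintegral_congr_ae (hν₁.mono fun y hy => ?_)
    exact lintegral_nextBlock_of_nonneg hr hy (f := fun p => H (y, p)) (by fun_prop)

namespace Regenerates

lemma hasLaw (h : Regenerates ν₁ ν₂ next) :
    HasLaw next (pathMeasure ν₁ ν₂) (pathMeasure ν₁ ν₂) where
  aemeasurable := h.measurable.aemeasurable
  map_eq := Measure.ext_of_lintegral _ fun f hf => by
    rw [lintegral_map hf h.measurable, h.lintegral_next (H := fun p => f p.2.2) (by fun_prop)]
    simp

lemma ae_nonneg (h : Regenerates ν₁ ν₂ next) (hnonneg : ∀ᵐ z ∂(pathMeasure ν₁ ν₂), z.Nonneg) :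
    ∀ᵐ z ∂(pathMeasure ν₁ ν₂), (next z).Nonneg :=
  ae_of_ae_map h.measurable.aemeasurable (by rwa [h.hasLaw.map_eq])

lemma setLIntegral_busy (h : Regenerates ν₁ ν₂ next) {f : SamplePath → ENNReal}
    (hf : Measurable f) :
    ∫⁻ z in {z | z.x 0 < z.s 0}, f (next z) ∂(pathMeasure ν₁ ν₂) =
      pathMeasure ν₁ ν₂ {z | z.x 0 < z.s 0} * ∫⁻ z, f z ∂(pathMeasure ν₁ ν₂) := by
  classical
  have hH : Measurable fun p : ℝ × Prop × SamplePath => if p.2.1 then f p.2.2 else 0 :=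
    Measurable.ite (measurableSet_setOfPred.2 (by fun_prop)) (by fun_prop) measurable_const
  have hsplit : ∀ z : SamplePath, (∫⁻ z', if z.x 0 < z.s 0 then f z' else 0 ∂(pathMeasure ν₁ ν₂)) =
      {z : SamplePath | z.x 0 < z.s 0}.indicator
        (fun _ => ∫⁻ z', f z' ∂(pathMeasure ν₁ ν₂)) z := by
    intro z
    by_cases hz : z.x 0 < z.s 0 <;> simp [hz]
  rw [← lintegral_indicator SamplePath.measurableSet_lt]
  refine (h.lintegral_next hH).trans ?_
  simp only [hsplit]
  rw [lintegral_indicator_const SamplePath.measurableSet_lt, mul_comm]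

lemma hasLaw_x_next (h : Regenerates ν₁ ν₂ next) :
    HasLaw (fun z => (z.x 0, next z)) (ν₁.prod (pathMeasure ν₁ ν₂)) (pathMeasure ν₁ ν₂) where
  aemeasurable := (Measurable.prodMk (by fun_prop) h.measurable).aemeasurable
  map_eq := Measure.ext_of_lintegral _ fun f hf => by
    rw [lintegral_map hf (Measurable.prodMk (by fun_prop) h.measurable), lintegral_prod f
        hf.aemeasurable, h.lintegral_next (H := fun p => f (p.1, p.2.2)) (by fun_prop)]
    exact (hasLaw_x 0).lintegral_comp (f := fun y => ∫⁻ z, f (y, z) ∂(pathMeasure ν₁ ν₂))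
      hf.lintegral_prod_right'.aemeasurable

lemma measure_x_next (h : Regenerates ν₁ ν₂ next) {A : Set (ℝ × SamplePath)}
    (hA : MeasurableSet A) :
    pathMeasure ν₁ ν₂ {z | (z.x 0, next z) ∈ A} =
      ∫⁻ y, pathMeasure ν₁ ν₂ {z | (y, z) ∈ A} ∂ν₁ :=
  (h.hasLaw_x_next.measure_eq (p := (· ∈ A)) hA).trans (Measure.prod_apply hA)

end Regenerates

end Regenerates

@[fun_prop]
lemma measurable_arrivalTime (k : ℕ) :
    Measurable fun x : ℕ → ℝ => arrivalTime x k := by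
  unfold arrivalTime
  fun_prop

/-- A service discipline at server 2, observed from a time `0` at which an update is in service
there and a fresh update is generated. `Delivered z k` says that the update generated at time
`arrivalTime z.x k` is eventually delivered, and `deliveryTime z k` is when. At the first arrival at
server 2 the same situation recurs, with the sample path `next z`. -/
structure Discipline where
  next : SamplePath → SamplePath
  Delivered : SamplePath → ℕ → Prop
  deliveryTime : SamplePath → ℕ → ℝ
  measurableSet_delivered : ∀ k, MeasurableSet {z | Delivered z k}
  measurable_deliveryTime : ∀ k, Measurable fun z => deliveryTime z k
  x_next : ∀ z i, (next z).x i = z.x (i + 1)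
  delivered_zero : ∀ z, Delivered z 0 ↔ z.s 0 ≤ z.x 0
  delivered_succ : ∀ z k, Delivered z (k + 1) ↔ Delivered (next z) k
  deliveryTime_succ : ∀ z k, deliveryTime z (k + 1) = z.x 0 + deliveryTime (next z) k
  deliveryTime_nonneg : ∀ z k, z.Nonneg → 0 ≤ deliveryTime z k
  deliveryTime_zero_le : ∀ z k, z.Nonneg → Delivered z 0 → Delivered z k →
    deliveryTime z 0 ≤ deliveryTime z k

namespace Discipline

variable (d : Discipline)

/-- The paths on which no update generated after time `u` is delivered by time `t`. -/
def noFresh (u t : ℝ) : Set SamplePath :=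
  {z | ∀ k, u < arrivalTime z.x k → d.Delivered z k → t < d.deliveryTime z k}

/-- The paths on which no update generated from time `0` on is delivered by time `t`. -/
def undelivered (t : ℝ) : Set SamplePath := {z | ∀ k, d.Delivered z k → t < d.deliveryTime z k}

/-- The time until the first delivery of an update generated from time `0` on, as the total length
of time before it. -/
noncomputable def delay (z : SamplePath) : ENNReal := volume (Set.Ioi 0 ∩ {t | z ∈ d.undelivered t})

/-- The long-run probability that the age is at least `a`. By memorylessness, `a` units of time ago
the step 1 in progress still needed a time `y` of law `ν₁`, and none of the updates generated from
its completion on has been delivered since. -/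
noncomputable def ageTail (ν₁ ν₂ : Measure ℝ) (a : ℝ) : ENNReal :=
  ∫⁻ y, pathMeasure ν₁ ν₂ (d.undelivered (a - y)) ∂ν₁

variable {d}

lemma measurableSet_noFresh :
    MeasurableSet {p : (ℝ × ℝ) × SamplePath | p.2 ∈ d.noFresh p.1.1 p.1.2} := by
  have hinter : {p : (ℝ × ℝ) × SamplePath | p.2 ∈ d.noFresh p.1.1 p.1.2} =
      ⋂ k, {p | p.1.1 < arrivalTime p.2.x k → d.Delivered p.2 k →
        p.1.2 < d.deliveryTime p.2 k} := by
    ext; simp [noFresh]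
  rw [hinter]
  refine MeasurableSet.iInter fun k => ?_
  have hdel := d.measurableSet_delivered k
  have htime := d.measurable_deliveryTime k
  exact (measurableSet_lt (by fun_prop) (by fun_prop)).imp
    ((measurable_snd hdel).imp (measurableSet_lt (by fun_prop) (by fun_prop)))

lemma measurableSet_undelivered :
    MeasurableSet {p : ℝ × SamplePath | p.2 ∈ d.undelivered p.1} := by
  have hinter : {p : ℝ × SamplePath | p.2 ∈ d.undelivered p.1} =
      ⋂ k, {p | d.Delivered p.2 k → p.1 < d.deliveryTime p.2 k} := by
    ext; simp [undelivered]
  rw [hinter]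
  refine MeasurableSet.iInter fun k => ?_
  have hdel := d.measurableSet_delivered k
  have htime := d.measurable_deliveryTime k
  exact (measurable_snd hdel).imp (measurableSet_lt (by fun_prop) (by fun_prop))

lemma arrivalTime_succ_next (z : SamplePath) (k : ℕ) :
    arrivalTime z.x (k + 1) = z.x 0 + arrivalTime (d.next z).x k := by
  simp only [arrivalTime, Finset.sum_range_succ', d.x_next, add_comm]

lemma mem_noFresh_iff_next {u : ℝ} (hu : 0 ≤ u) {t : ℝ} {z : SamplePath} :
    z ∈ d.noFresh u t ↔ d.next z ∈ d.noFresh (u - z.x 0) (t - z.x 0) := by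
  have hzero : u < arrivalTime z.x 0 ↔ False := by simpa [arrivalTime] using hu
  simp only [noFresh, Set.mem_ofPred_eq]
  rw [← Nat.and_forall_add_one]
  simp only [hzero, arrivalTime_succ_next (d := d), d.delivered_succ, d.deliveryTime_succ,
    sub_lt_iff_lt_add', false_imp_iff, true_and]

lemma mem_noFresh_iff_mem_undelivered {u : ℝ} (hu : u < 0) {t : ℝ} {z : SamplePath}
    (hz : z.Nonneg) : z ∈ d.noFresh u t ↔ z ∈ d.undelivered t :=
  forall_congr' fun _ => forall_prop_of_true
    (hu.trans_le (Finset.sum_nonneg fun i _ => hz.1 i))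

lemma mem_undelivered_of_neg {t : ℝ} (ht : t < 0) {z : SamplePath} (hz : z.Nonneg) :
    z ∈ d.undelivered t := fun k _ => ht.trans_le (d.deliveryTime_nonneg z k hz)

lemma mem_undelivered_iff_of_le {t : ℝ} {z : SamplePath} (hz : z.Nonneg) (hdone : z.s 0 ≤ z.x 0) :
    z ∈ d.undelivered t ↔ t < d.deliveryTime z 0 :=
  have h0 := (d.delivered_zero z).2 hdone
  ⟨fun h => h 0 h0, fun ht k hk => ht.trans_le (d.deliveryTime_zero_le z k hz h0 hk)⟩

lemma mem_undelivered_iff_next {t : ℝ} {z : SamplePath} (hbusy : z.x 0 < z.s 0) :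
    z ∈ d.undelivered t ↔ d.next z ∈ d.undelivered (t - z.x 0) := by
  simp only [undelivered, Set.mem_ofPred_eq]
  rw [← Nat.and_forall_add_one]
  simp only [d.delivered_zero, hbusy.not_ge, d.delivered_succ, d.deliveryTime_succ,
    sub_lt_iff_lt_add', false_imp_iff, true_and]

lemma delay_of_le {z : SamplePath} (hz : z.Nonneg) (hdone : z.s 0 ≤ z.x 0) :
    d.delay z = ENNReal.ofReal (d.deliveryTime z 0) := by
  have hIoo : Set.Ioi 0 ∩ {t | z ∈ d.undelivered t} = Set.Ioo 0 (d.deliveryTime z 0) := by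
    ext t
    simp [mem_undelivered_iff_of_le hz hdone]
  rw [delay, hIoo, Real.volume_Ioo, sub_zero]

lemma delay_of_lt {z : SamplePath} (hz : z.Nonneg) (hz' : (d.next z).Nonneg)
    (hbusy : z.x 0 < z.s 0) : d.delay z = ENNReal.ofReal (z.x 0) + d.delay (d.next z) := by
  have hpre : {t | z ∈ d.undelivered t} =
      (fun t => t - z.x 0) ⁻¹' {t | d.next z ∈ d.undelivered t} :=
    Set.ext fun t => mem_undelivered_iff_next hbusy
  have hmeas : MeasurableSet {t | d.next z ∈ d.undelivered t} :=
    measurable_prodMk_right measurableSet_undelivered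
  rw [delay, hpre,
    volume_Ioi_inter_sub_preimage hmeas (fun t ht => mem_undelivered_of_neg ht hz') (hz.1 0), delay]

section PathMeasure

variable {ν₁ ν₂ : Measure ℝ} [IsProbabilityMeasure ν₁] [IsProbabilityMeasure ν₂]

lemma measurable_measure_undelivered :
    Measurable fun t => pathMeasure ν₁ ν₂ (d.undelivered t) :=
  measurable_measure_prodMk_left measurableSet_undelivered

lemma measurable_delay : Measurable d.delay :=
  measurable_measure_prodMk_right
    ((measurable_fst measurableSet_Ioi).inter measurableSet_undelivered)

lemma lintegral_measure_undelivered_sub (hν₁ : ∀ᵐ y ∂ν₁, 0 ≤ y) (hν₂ : ∀ᵐ v ∂ν₂, 0 ≤ v) {y : ℝ}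
    (hy : 0 ≤ y) :
    ∫⁻ a in Set.Ioi 0, pathMeasure ν₁ ν₂ (d.undelivered (a - y)) =
      ENNReal.ofReal y + ∫⁻ z, d.delay z ∂(pathMeasure ν₁ ν₂) := by
  have hmeas : MeasurableSet {p : ℝ × SamplePath | p.2 ∈ d.undelivered (p.1 - y)} :=
    measurableSet_undelivered.preimage
      (by fun_prop : Measurable fun p : ℝ × SamplePath => (p.1 - y, p.2))
  calc ∫⁻ a in Set.Ioi 0, pathMeasure ν₁ ν₂ (d.undelivered (a - y))
      = ∫⁻ z, volume (Set.Ioi 0 ∩ {a | z ∈ d.undelivered (a - y)}) ∂(pathMeasure ν₁ ν₂) := by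
        refine (Measure.prod_apply hmeas).symm.trans ((Measure.prod_apply_symm hmeas).trans ?_)
        refine lintegral_congr fun z => ?_
        rw [Measure.restrict_apply (measurable_prodMk_right hmeas), Set.inter_comm]
        rfl
    _ = ∫⁻ z, (ENNReal.ofReal y + d.delay z) ∂(pathMeasure ν₁ ν₂) := by
        refine lintegral_congr_ae ((SamplePath.ae_nonneg hν₁ hν₂).mono fun z hz => ?_)
        exact volume_Ioi_inter_sub_preimage (measurable_prodMk_right measurableSet_undelivered)
          (fun t ht => mem_undelivered_of_neg ht hz) hy
    _ = ENNReal.ofReal y + ∫⁻ z, d.delay z ∂(pathMeasure ν₁ ν₂) := by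
        rw [lintegral_add_left measurable_const, lintegral_const, measure_univ, mul_one]

lemma lintegral_ageTail (hν₁ : ∀ᵐ y ∂ν₁, 0 ≤ y) (hν₂ : ∀ᵐ v ∂ν₂, 0 ≤ v) :
    ∫⁻ a in Set.Ioi 0, d.ageTail ν₁ ν₂ a =
      ∫⁻ y, ENNReal.ofReal y ∂ν₁ + ∫⁻ z, d.delay z ∂(pathMeasure ν₁ ν₂) := by
  have hmeas : Measurable fun p : ℝ × ℝ => pathMeasure ν₁ ν₂ (d.undelivered (p.1 - p.2)) :=
    measurable_measure_undelivered.comp (measurable_fst.sub measurable_snd)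
  calc ∫⁻ a in Set.Ioi 0, d.ageTail ν₁ ν₂ a
      = ∫⁻ y, (∫⁻ a in Set.Ioi 0, pathMeasure ν₁ ν₂ (d.undelivered (a - y))) ∂ν₁ :=
        lintegral_lintegral_swap (f := fun a y => pathMeasure ν₁ ν₂ (d.undelivered (a - y)))
          hmeas.aemeasurable
    _ = ∫⁻ y, (ENNReal.ofReal y + ∫⁻ z, d.delay z ∂(pathMeasure ν₁ ν₂)) ∂ν₁ :=
        lintegral_congr_ae (hν₁.mono fun y hy => lintegral_measure_undelivered_sub hν₁ hν₂ hy)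
    _ = ∫⁻ y, ENNReal.ofReal y ∂ν₁ + ∫⁻ z, d.delay z ∂(pathMeasure ν₁ ν₂) := by
        rw [lintegral_add_right _ measurable_const, lintegral_const, measure_univ, mul_one]

lemma measure_done_mul_lintegral_delay (hν₁ : ∀ᵐ y ∂ν₁, 0 ≤ y) (hν₂ : ∀ᵐ v ∂ν₂, 0 ≤ v)
    (hnext : Regenerates ν₁ ν₂ d.next) (hdone : pathMeasure ν₁ ν₂ {z | z.s 0 ≤ z.x 0} ≠ 0)
    {C : SamplePath → ENNReal} (hC : Measurable C) (hC1 : ∫⁻ z, C z ∂(pathMeasure ν₁ ν₂) ≠ ⊤)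
    (hCdone : ∀ z : SamplePath, z.Nonneg → z.s 0 ≤ z.x 0 →
      C z = ENNReal.ofReal (d.deliveryTime z 0))
    (hCbusy : ∀ z : SamplePath, z.x 0 < z.s 0 → C z = ENNReal.ofReal (z.x 0)) :
    pathMeasure ν₁ ν₂ {z | z.s 0 ≤ z.x 0} * ∫⁻ z, d.delay z ∂(pathMeasure ν₁ ν₂) =
      ∫⁻ z, C z ∂(pathMeasure ν₁ ν₂) := by
  have hcompl : {z : SamplePath | z.x 0 < z.s 0}ᶜ = {z | z.s 0 ≤ z.x 0} := by ext; simp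
  rw [← hcompl] at hdone ⊢
  have hnonneg := SamplePath.ae_nonneg hν₁ hν₂
  refine measure_compl_mul_lintegral_of_regeneration SamplePath.measurableSet_lt hC
    measurable_delay (fun f hf => hnext.setLIntegral_busy hf) ?_ hdone hC1
  filter_upwards [hnonneg, hnext.ae_nonneg hnonneg] with z hz hz'
  rcases lt_or_ge (z.x 0) (z.s 0) with hbusy | hle
  · simp [hbusy, hCbusy z hbusy, delay_of_lt hz hz' hbusy]
  · simp [hle.not_gt, hCdone z hz hle, delay_of_le hz hle]

lemma measure_next_mem_noFresh {next : SamplePath → SamplePath} (hnext : Regenerates ν₁ ν₂ next)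
    (u t : ℝ) :
    pathMeasure ν₁ ν₂ {z | next z ∈ d.noFresh (u - z.x 0) (t - z.x 0)} =
      ∫⁻ y, pathMeasure ν₁ ν₂ (d.noFresh (u - y) (t - y)) ∂ν₁ := by
  have hmeas : MeasurableSet {p : ℝ × SamplePath | p.2 ∈ d.noFresh (u - p.1) (t - p.1)} :=
    measurableSet_noFresh.preimage
      (by fun_prop : Measurable fun p : ℝ × SamplePath => ((u - p.1, t - p.1), p.2))
  exact hnext.measure_x_next hmeas

end PathMeasure

section ExponentialArrivals

variable {μ₁ : ℝ} {ν₂ : Measure ℝ} [IsProbabilityMeasure ν₂]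

lemma lintegral_measure_noFresh_eq_add (hμ₁ : 0 < μ₁) (hν₂ : ∀ᵐ v ∂ν₂, 0 ≤ v) {u : ℝ} (hu : 0 ≤ u)
    (a : ℝ) :
    ∫⁻ y, pathMeasure (expMeasure μ₁) ν₂ (d.noFresh (u - y) (u + a - y)) ∂(expMeasure μ₁) =
      ENNReal.ofReal (Real.exp (-(μ₁ * u))) * d.ageTail (expMeasure μ₁) ν₂ a +
        ∫⁻ y in Set.Iic u, pathMeasure (expMeasure μ₁) ν₂ (d.noFresh (u - y) (u - y + a))
          ∂(expMeasure μ₁) := by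
  have := isProbabilityMeasure_expMeasure hμ₁
  have hnonneg := SamplePath.ae_nonneg (ae_expMeasure_nonneg hμ₁) hν₂
  rw [← lintegral_add_compl _ measurableSet_Iic (A := Set.Iic u), Set.compl_Iic, add_comm]
  congr 1
  · rw [ageTail, ← setLIntegral_Ioi_sub_expMeasure hu fun y =>
      pathMeasure (expMeasure μ₁) ν₂ (d.undelivered (a - y))]
    refine setLIntegral_congr_fun measurableSet_Ioi fun y hy => ?_
    refine measure_congr (hnonneg.mono fun z hz => propext ?_)
    rw [show a - (y - u) = u + a - y by ring]
    exact mem_noFresh_iff_mem_undelivered (sub_neg.2 hy) hz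
  · simp only [add_sub_right_comm]

lemma measure_noFresh (hμ₁ : 0 < μ₁) (hν₂ : ∀ᵐ v ∂ν₂, 0 ≤ v)
    (hnext : Regenerates (expMeasure μ₁) ν₂ d.next) {u : ℝ} (hu : 0 ≤ u) (a : ℝ) :
    pathMeasure (expMeasure μ₁) ν₂ (d.noFresh u (u + a)) = d.ageTail (expMeasure μ₁) ν₂ a := by
  have := isProbabilityMeasure_expMeasure hμ₁
  set κ := d.ageTail (expMeasure μ₁) ν₂ a
  have hfirst : ∀ u, 0 ≤ u → pathMeasure (expMeasure μ₁) ν₂ (d.noFresh u (u + a)) =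
      ENNReal.ofReal (Real.exp (-(μ₁ * u))) * κ +
        ∫⁻ y in Set.Iic u, pathMeasure (expMeasure μ₁) ν₂ (d.noFresh (u - y) (u - y + a))
          ∂(expMeasure μ₁) := fun u hu => by
    rw [← lintegral_measure_noFresh_eq_add hμ₁ hν₂ hu, ← measure_next_mem_noFresh hnext]
    exact measure_congr (ae_of_all _ fun z => propext (mem_noFresh_iff_next hu))
  have hconst : ∀ u, 0 ≤ u → κ = ENNReal.ofReal (Real.exp (-(μ₁ * u))) * κ +
      ∫⁻ _ in Set.Iic u, κ ∂(expMeasure μ₁) := fun u hu => by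
    rw [setLIntegral_const, mul_comm κ, ← add_mul, ← expMeasure_Ioi hμ₁ hu, ← Set.compl_Iic,
      add_comm, measure_add_measure_compl measurableSet_Iic, measure_univ, one_mul]
  have hκ1 : κ ≤ 1 := (lintegral_mono fun y => prob_le_one).trans (by simp)
  exact renewal_unique (ae_expMeasure_nonneg hμ₁)
    (fun t ht => expMeasure_Iic_lt_one hμ₁ ht) (fun _ _ => prob_le_one) (fun _ _ => hκ1) hfirst
    hconst hu

lemma measure_next_mem_noFresh_eq_ageTail (hμ₁ : 0 < μ₁) (hν₂ : ∀ᵐ v ∂ν₂, 0 ≤ v)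
    (hnext : Regenerates (expMeasure μ₁) ν₂ d.next) {next : SamplePath → SamplePath}
    (hnext' : Regenerates (expMeasure μ₁) ν₂ next) {u : ℝ} (hu : 0 ≤ u) (a : ℝ) :
    pathMeasure (expMeasure μ₁) ν₂ {z | next z ∈ d.noFresh (u - z.x 0) (u + a - z.x 0)} =
      d.ageTail (expMeasure μ₁) ν₂ a := by
  have := isProbabilityMeasure_expMeasure hμ₁
  rw [measure_next_mem_noFresh hnext', ← measure_next_mem_noFresh hnext,
    ← measure_noFresh hμ₁ hν₂ hnext hu]
  exact measure_congr (ae_of_all _ fun z => propext (mem_noFresh_iff_next hu).symm)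

end ExponentialArrivals

end Discipline

/-! ### The two disciplines at server 2 -/

section Paths

variable {x s : ℕ → ℝ}

lemma arrivalTime_zero (x : ℕ → ℝ) : arrivalTime x 0 = 0 := by simp [arrivalTime]

lemma arrivalTime_succ (x : ℕ → ℝ) (k : ℕ) :
    arrivalTime x (k + 1) = x 0 + arrivalTime (fun i => x (i + 1)) k := by
  rw [arrivalTime, Finset.sum_range_succ', add_comm]; rfl

lemma arrivalTime_nonneg (hx : ∀ k, 0 ≤ x k) (k : ℕ) : 0 ≤ arrivalTime x k :=
  Finset.sum_nonneg fun i _ => hx i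

lemma arrivalTime_mono (hx : ∀ k, 0 ≤ x k) : Monotone (arrivalTime x) :=
  monotone_nat_of_le_succ fun k => by
    simpa only [arrivalTime, Finset.sum_range_succ] using le_add_of_nonneg_right (hx k)

lemma freeTime_succ (q : ServerState) (x s : ℕ → ℝ) (k : ℕ) :
    freeTime q x s (k + 1) =
      if freeTime q x s k ≤ arrivalTime x (k + 1) then arrivalTime x (k + 1) + s (k + 1)
      else freeTime q x s k := rfl

lemma freeTime_mono (q : ServerState) (hs : ∀ k, 0 ≤ s k) : Monotone (freeTime q x s) :=
  monotone_nat_of_le_succ fun k => by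
    rw [freeTime_succ]
    split_ifs with hfree
    · exact hfree.trans (le_add_of_nonneg_right (hs _))
    · exact le_rfl

lemma freeTime_idle_succ {z : SamplePath} (hx : 0 ≤ z.x 0) (k : ℕ) :
    freeTime 0 z.x z.s (k + 1) = z.x 0 + freeTime 1 z.tail.x z.tail.s k := by
  induction k with
  | zero => simp [freeTime, arrivalTime, SamplePath.s_tail, hx]
  | succ k ih =>
    rw [freeTime_succ, ih, freeTime_succ 1, arrivalTime_succ]
    simp only [← SamplePath.x_tail, ← SamplePath.s_tail, add_le_add_iff_left]
    split_ifs <;> ring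

lemma freeTime_busy_succ (z : SamplePath) (k : ℕ) :
    freeTime 1 z.x z.s (k + 1) = z.x 0 + freeTime 1 z.nextBlock.x z.nextBlock.s k := by
  induction k with
  | zero =>
    rw [freeTime_succ, arrivalTime_succ, arrivalTime_zero, add_zero]
    simp only [freeTime, SamplePath.s_nextBlock_zero, if_true]
    split_ifs <;> ring
  | succ k ih =>
    rw [freeTime_succ, ih, freeTime_succ 1, arrivalTime_succ]
    simp only [← SamplePath.x_nextBlock, ← SamplePath.s_nextBlock_succ, add_le_add_iff_left]
    split_ifs <;> ring

lemma freeTime_of_accepted {q : ServerState} {k : ℕ} (h : Accepted q x s k) :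
    freeTime q x s k = arrivalTime x k + s k := by
  cases k with
  | zero => rw [freeTime, if_pos (show q = 1 from h), arrivalTime_zero, zero_add]
  | succ k => exact if_pos h

@[fun_prop]
lemma measurable_freeTime (q : ServerState) (k : ℕ) :
    Measurable fun z : SamplePath => freeTime q z.x z.s k := by
  induction k with
  | zero => exact Measurable.ite (MeasurableSet.const _) (by fun_prop) measurable_const
  | succ k ih =>
    simp only [freeTime_succ]
    exact Measurable.ite (measurableSet_le ih (by fun_prop)) (by fun_prop) ih

lemma measurableSet_accepted (q : ServerState) (k : ℕ) :
    MeasurableSet {z : SamplePath | Accepted q z.x z.s k} := by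
  cases k with
  | zero => exact MeasurableSet.const _
  | succ k => exact measurableSet_le (by fun_prop) (by fun_prop)

end Paths

/-- Preemption in service: the update generated at an arrival is the one that arrives, and it is
delivered if its service ends before the next arrival. -/
def preempting : Discipline where
  next := SamplePath.tail
  Delivered z k := arrivalTime z.x k + z.s k ≤ arrivalTime z.x (k + 1)
  deliveryTime z k := arrivalTime z.x k + z.s k
  measurableSet_delivered k := measurableSet_le (by fun_prop) (by fun_prop)
  measurable_deliveryTime k := by fun_prop
  x_next := SamplePath.x_tail
  delivered_zero z := by simp [arrivalTime]
  delivered_succ z k := by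
    rw [arrivalTime_succ z.x k, arrivalTime_succ z.x (k + 1), add_assoc, add_le_add_iff_left]
    rfl
  deliveryTime_succ z k := by rw [arrivalTime_succ, add_assoc]; rfl
  deliveryTime_nonneg z k hz := add_nonneg (arrivalTime_nonneg hz.1 k) (hz.2 k)
  deliveryTime_zero_le z k hz hfirst _ := by
    cases k with
    | zero => exact le_rfl
    | succ k =>
      exact (hfirst.trans (arrivalTime_mono hz.1 (Nat.le_add_left 1 k))).trans
        (le_add_of_nonneg_right (hz.2 _))

/-- Blocking: the update generated when update `k` arrives is update `k + 1`, and it is delivered if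
server 2 is idle when it arrives. -/
noncomputable def blocking : Discipline where
  next := SamplePath.nextBlock
  Delivered z k := Accepted 1 z.x z.s (k + 1)
  deliveryTime z k := arrivalTime z.x (k + 1) + z.s (k + 1)
  measurableSet_delivered k := measurableSet_accepted 1 (k + 1)
  measurable_deliveryTime k := by fun_prop
  x_next := SamplePath.x_nextBlock
  delivered_zero z := by simp [Accepted, freeTime, arrivalTime]
  delivered_succ z k := by
    simp only [Accepted, freeTime_busy_succ, arrivalTime_succ z.x (k + 1),
      ← SamplePath.x_nextBlock, add_le_add_iff_left]
  deliveryTime_succ z k := by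
    rw [arrivalTime_succ, SamplePath.s_nextBlock_succ, add_assoc]
    simp only [← SamplePath.x_nextBlock]
  deliveryTime_nonneg z k hz := add_nonneg (arrivalTime_nonneg hz.1 _) (hz.2 _)
  deliveryTime_zero_le z k hz hfirst hk := by
    rw [← freeTime_of_accepted hfirst, ← freeTime_of_accepted hk]
    exact freeTime_mono 1 hz.2 (Nat.le_add_left 1 k)

/-! ### Average ages -/

section Constants

variable {μ₁ μ₂ : ℝ}

lemma measure_x_lt_s (hμ₁ : 0 < μ₁) (hμ₂ : 0 < μ₂) :
    pathMeasure (expMeasure μ₁) (expMeasure μ₂) {z | z.x 0 < z.s 0} =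
      ENNReal.ofReal (μ₁ / (μ₁ + μ₂)) := by
  have := isProbabilityMeasure_expMeasure hμ₁
  have := isProbabilityMeasure_expMeasure hμ₂
  have hlt : MeasurableSet {p : ℝ × ℝ | p.1 < p.2} := measurableSet_lt measurable_fst measurable_snd
  calc pathMeasure (expMeasure μ₁) (expMeasure μ₂) {z | z.x 0 < z.s 0}
      = ((expMeasure μ₁).prod (expMeasure μ₂)) {p | p.1 < p.2} := by
        rw [← hasLaw_head.map_eq, Measure.map_apply_of_aemeasurable hasLaw_head.aemeasurable hlt]
        rfl
    _ = ∫⁻ y, ENNReal.ofReal (Real.exp (-(μ₂ * y))) ∂(expMeasure μ₁) := by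
        rw [Measure.prod_apply hlt]
        exact lintegral_congr_ae ((ae_expMeasure_nonneg hμ₁).mono fun y hy => expMeasure_Ioi hμ₂ hy)
    _ = ENNReal.ofReal (μ₁ / (μ₁ + μ₂)) := lintegral_expMeasure_ofReal_exp hμ₁ hμ₂.le

lemma measure_s_le_x (hμ₁ : 0 < μ₁) (hμ₂ : 0 < μ₂) :
    pathMeasure (expMeasure μ₁) (expMeasure μ₂) {z | z.s 0 ≤ z.x 0} =
      ENNReal.ofReal (μ₂ / (μ₁ + μ₂)) := by
  have := isProbabilityMeasure_expMeasure hμ₁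
  have := isProbabilityMeasure_expMeasure hμ₂
  have hcompl : {z : SamplePath | z.s 0 ≤ z.x 0} = {z | z.x 0 < z.s 0}ᶜ := by ext; simp
  rw [hcompl, prob_compl_eq_one_sub SamplePath.measurableSet_lt, measure_x_lt_s hμ₁ hμ₂,
    ← ENNReal.ofReal_one, ← ENNReal.ofReal_sub _ (by positivity)]
  congr 1
  field_simp
  ring

lemma measure_lt_min_x_s (hμ₁ : 0 < μ₁) (hμ₂ : 0 < μ₂) {t : ℝ} (ht : 0 ≤ t) :
    pathMeasure (expMeasure μ₁) (expMeasure μ₂) {z | t < min (z.x 0) (z.s 0)} =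
      ENNReal.ofReal (Real.exp (-((μ₁ + μ₂) * t))) := by
  have := isProbabilityMeasure_expMeasure hμ₁
  have := isProbabilityMeasure_expMeasure hμ₂
  have hpre : {z : SamplePath | t < min (z.x 0) (z.s 0)} =
      (fun z : SamplePath => (z.x 0, z.s 0)) ⁻¹' (Set.Ioi t ×ˢ Set.Ioi t) := by
    ext; simp
  rw [hpre, ← Measure.map_apply (by fun_prop) (measurableSet_Ioi.prod measurableSet_Ioi),
    hasLaw_head.map_eq, Measure.prod_prod, expMeasure_Ioi hμ₁ ht, expMeasure_Ioi hμ₂ ht,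
    ← ENNReal.ofReal_mul (Real.exp_pos _).le, ← Real.exp_add]
  ring_nf

lemma lintegral_x (hμ₁ : 0 < μ₁) {ν₂ : Measure ℝ} [IsProbabilityMeasure ν₂] (k : ℕ) :
    ∫⁻ z, ENNReal.ofReal (z.x k) ∂(pathMeasure (expMeasure μ₁) ν₂) = ENNReal.ofReal (1 / μ₁) := by
  have := isProbabilityMeasure_expMeasure hμ₁
  rw [← lintegral_ofReal_expMeasure hμ₁]
  exact (hasLaw_x k).lintegral_comp (f := ENNReal.ofReal) (by fun_prop)

lemma lintegral_s {ν₁ : Measure ℝ} [IsProbabilityMeasure ν₁] (hμ₂ : 0 < μ₂) (k : ℕ) :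
    ∫⁻ z, ENNReal.ofReal (z.s k) ∂(pathMeasure ν₁ (expMeasure μ₂)) = ENNReal.ofReal (1 / μ₂) := by
  have := isProbabilityMeasure_expMeasure hμ₂
  rw [← lintegral_ofReal_expMeasure hμ₂]
  exact (hasLaw_s k).lintegral_comp (f := ENNReal.ofReal) (by fun_prop)

lemma setLIntegral_s_one (hμ₁ : 0 < μ₁) (hμ₂ : 0 < μ₂) :
    ∫⁻ z in {z | z.s 0 ≤ z.x 0}, ENNReal.ofReal (z.s 1)
      ∂(pathMeasure (expMeasure μ₁) (expMeasure μ₂)) = ENNReal.ofReal (1 / (μ₁ + μ₂)) := by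
  have := isProbabilityMeasure_expMeasure hμ₁
  have := isProbabilityMeasure_expMeasure hμ₂
  have hsum : ∫⁻ z in {z | z.x 0 < z.s 0}, ENNReal.ofReal (z.s 1)
      ∂(pathMeasure (expMeasure μ₁) (expMeasure μ₂)) =
        ENNReal.ofReal (μ₁ / (μ₁ + μ₂) * (1 / μ₂)) := by
    rw [ENNReal.ofReal_mul (by positivity), ← measure_x_lt_s hμ₁ hμ₂,
      ← lintegral_s (ν₁ := expMeasure μ₁) hμ₂ 0]
    exact regenerates_tail.setLIntegral_busy (f := fun z => ENNReal.ofReal (z.s 0)) (by fun_prop)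
  have hcompl : {z : SamplePath | z.x 0 < z.s 0}ᶜ = {z | z.s 0 ≤ z.x 0} := by ext; simp
  have htotal := lintegral_add_compl
    (μ := pathMeasure (expMeasure μ₁) (expMeasure μ₂)) (fun z => ENNReal.ofReal (z.s 1))
    SamplePath.measurableSet_lt
  rw [hcompl, hsum, lintegral_s hμ₂] at htotal
  rw [← ENNReal.add_right_inj ENNReal.ofReal_ne_top, htotal,
    ← ENNReal.ofReal_add (by positivity) (by positivity)]
  congr 1
  field_simp

lemma Discipline.lintegral_delay {d : Discipline} (hμ₁ : 0 < μ₁) (hμ₂ : 0 < μ₂)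
    (hnext : Regenerates (expMeasure μ₁) (expMeasure μ₂) d.next) {C : SamplePath → ENNReal}
    (hC : Measurable C) {c : ℝ}
    (hC1 : ∫⁻ z, C z ∂(pathMeasure (expMeasure μ₁) (expMeasure μ₂)) = ENNReal.ofReal c)
    (hCdone : ∀ z : SamplePath, z.Nonneg → z.s 0 ≤ z.x 0 →
      C z = ENNReal.ofReal (d.deliveryTime z 0))
    (hCbusy : ∀ z : SamplePath, z.x 0 < z.s 0 → C z = ENNReal.ofReal (z.x 0)) :
    ∫⁻ z, d.delay z ∂(pathMeasure (expMeasure μ₁) (expMeasure μ₂)) =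
      ENNReal.ofReal ((μ₁ + μ₂) / μ₂ * c) := by
  have := isProbabilityMeasure_expMeasure hμ₁
  have := isProbabilityMeasure_expMeasure hμ₂
  have hpos : ENNReal.ofReal (μ₂ / (μ₁ + μ₂)) ≠ 0 :=
    (ENNReal.ofReal_pos.2 (by positivity)).ne'
  have hmul := measure_done_mul_lintegral_delay (ae_expMeasure_nonneg hμ₁)
    (ae_expMeasure_nonneg hμ₂) hnext (by rwa [measure_s_le_x hμ₁ hμ₂]) hC
    (hC1 ▸ ENNReal.ofReal_ne_top) hCdone hCbusy
  rw [measure_s_le_x hμ₁ hμ₂, hC1] at hmul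
  rw [← ENNReal.mul_right_inj hpos ENNReal.ofReal_ne_top, hmul,
    ← ENNReal.ofReal_mul (by positivity)]
  congr 1
  field_simp

lemma regenerates_preempting {ν₁ ν₂ : Measure ℝ} [IsProbabilityMeasure ν₁]
    [IsProbabilityMeasure ν₂] : Regenerates ν₁ ν₂ preempting.next := regenerates_tail

lemma regenerates_blocking (hμ₁ : 0 < μ₁) (hμ₂ : 0 < μ₂) :
    Regenerates (expMeasure μ₁) (expMeasure μ₂) blocking.next :=
  have := isProbabilityMeasure_expMeasure hμ₁
  regenerates_nextBlock hμ₂ (ae_expMeasure_nonneg hμ₁)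

lemma lintegral_delay_preempting (hμ₁ : 0 < μ₁) (hμ₂ : 0 < μ₂) :
    ∫⁻ z, preempting.delay z ∂(pathMeasure (expMeasure μ₁) (expMeasure μ₂)) =
      ENNReal.ofReal (1 / μ₂) := by
  have := isProbabilityMeasure_expMeasure hμ₁
  have := isProbabilityMeasure_expMeasure hμ₂
  have hmin : ∫⁻ z : SamplePath, ENNReal.ofReal (min (z.x 0) (z.s 0))
      ∂(pathMeasure (expMeasure μ₁) (expMeasure μ₂)) = ENNReal.ofReal (1 / (μ₁ + μ₂)) :=
    lintegral_of_exponential_tail (add_pos hμ₁ hμ₂) (by fun_prop)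
      ((SamplePath.ae_nonneg (ae_expMeasure_nonneg hμ₁) (ae_expMeasure_nonneg hμ₂)).mono
        fun z hz => le_min (hz.1 0) (hz.2 0))
      fun t ht => measure_lt_min_x_s hμ₁ hμ₂ ht.le
  rw [Discipline.lintegral_delay hμ₁ hμ₂ regenerates_preempting (by fun_prop) hmin]
  · congr 1
    field_simp
  · intro z _ hdone
    simp [preempting, arrivalTime, hdone]
  · intro z hbusy
    simp [hbusy.le]

lemma lintegral_delay_blocking (hμ₁ : 0 < μ₁) (hμ₂ : 0 < μ₂) :
    ∫⁻ z, blocking.delay z ∂(pathMeasure (expMeasure μ₁) (expMeasure μ₂)) =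
      ENNReal.ofReal (1 / μ₁ + 2 / μ₂) := by
  have := isProbabilityMeasure_expMeasure hμ₁
  have := isProbabilityMeasure_expMeasure hμ₂
  have hdone : MeasurableSet {z : SamplePath | z.s 0 ≤ z.x 0} :=
    measurableSet_le (by fun_prop) (by fun_prop)
  have hmeas : Measurable ({z : SamplePath | z.s 0 ≤ z.x 0}.indicator
      fun z => ENNReal.ofReal (z.s 1)) := Measurable.indicator (by fun_prop) hdone
  have hC : ∫⁻ z, (ENNReal.ofReal (z.x 0) + {z : SamplePath | z.s 0 ≤ z.x 0}.indicator
      (fun z => ENNReal.ofReal (z.s 1)) z) ∂(pathMeasure (expMeasure μ₁) (expMeasure μ₂)) =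
        ENNReal.ofReal (1 / μ₁ + 1 / (μ₁ + μ₂)) := by
    rw [lintegral_add_right _ hmeas, lintegral_indicator hdone, lintegral_x hμ₁,
      setLIntegral_s_one hμ₁ hμ₂, ENNReal.ofReal_add (by positivity) (by positivity)]
  rw [Discipline.lintegral_delay hμ₁ hμ₂ (regenerates_blocking hμ₁ hμ₂) (by fun_prop) hC]
  · congr 1
    field_simp
    ring
  · intro z hz hdone
    simp [blocking, arrivalTime, hdone, ENNReal.ofReal_add (hz.1 0) (hz.2 1)]
  · intro z hbusy
    simp [hbusy]

end Constants

section Averages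

variable {Ω : Type*} [MeasurableSpace Ω] {P : Measure Ω} {Δ : ℝ → Ω → ℝ} {a₀ : ℝ} {κ : ℝ → ENNReal}

lemma measure_le_age_le [IsProbabilityMeasure P] (ha₀ : 0 ≤ a₀) {t : ℝ}
    (hb : ∀ᵐ ω ∂P, Δ t ω ≤ t + a₀)
    (htail : ∀ a, 0 < a → a ≤ t → P {ω | a ≤ Δ t ω} = κ a) (a : ℝ) :
    P {ω | a ≤ Δ t ω} ≤
      (Set.Iic a₀).indicator 1 a + (Set.Ioi 0).indicator κ (a - a₀) := by
  rcases le_or_gt a a₀ with ha | ha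
  · rw [Set.indicator_of_mem (Set.mem_Iic.2 ha)]
    exact le_add_right prob_le_one
  simp only [Set.indicator, Set.mem_Iic, ha.not_ge, if_false, Set.mem_Ioi, sub_pos, ha, if_true,
    zero_add]
  rcases le_or_gt (a - a₀) t with hat | hat
  · rw [← htail (a - a₀) (sub_pos.2 ha) hat]
    exact measure_mono fun ω => (sub_le_self a ha₀).trans
  · refine (measure_eq_zero_iff_ae_notMem.2 (hb.mono fun ω hω hle => ?_)).trans_le zero_le
    exact (hle.trans hω).not_gt (lt_sub_iff_add_lt.1 hat)

lemma setLIntegral_indicator_add_indicator_sub :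
    ∫⁻ a in Set.Ioi 0, ((Set.Iic a₀).indicator 1 a + (Set.Ioi 0).indicator κ (a - a₀)) ≤
      ENNReal.ofReal a₀ + ∫⁻ a in Set.Ioi 0, κ a := by
  rw [lintegral_add_left (measurable_one.indicator measurableSet_Iic),
    lintegral_indicator_one measurableSet_Iic, Measure.restrict_apply measurableSet_Iic,
    Set.inter_comm, Set.Ioi_inter_Iic, Real.volume_Ioc, sub_zero,
    ← lintegral_indicator (f := κ) measurableSet_Ioi]
  exact add_le_add_right
    ((setLIntegral_le_lintegral _ _).trans_eq (lintegral_sub_right_eq_self _ a₀)) _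

lemma isAverageAge_of_tail [IsProbabilityMeasure P] (ha₀ : 0 ≤ a₀) {m : ℝ} (hm : 0 ≤ m)
    (hΔ : ∀ t, 0 ≤ t → AEMeasurable (Δ t) P)
    (hb : ∀ t, 0 ≤ t → ∀ᵐ ω ∂P, 0 ≤ Δ t ω ∧ Δ t ω ≤ t + a₀)
    (htail : ∀ t a, 0 < a → a ≤ t → P {ω | a ≤ Δ t ω} = κ a)
    (hκm : ∫⁻ a in Set.Ioi 0, κ a = ENNReal.ofReal m) : IsAverageAge P Δ m := by
  refine ⟨fun t ht => Integrable.of_bound (hΔ t ht).aestronglyMeasurable (t + a₀) ?_, ?_⟩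
  · exact (hb t ht).mono fun ω hω => (Real.norm_of_nonneg hω.1).trans_le hω.2
  have hanti : ∀ t, Antitone fun a => P {ω | a ≤ Δ t ω} := fun t a b hab =>
    measure_mono fun ω => hab.trans
  have hlayer : ∀ t, 0 ≤ t →
      ∫ ω, Δ t ω ∂P = (∫⁻ a in Set.Ioi 0, P {ω | a ≤ Δ t ω}).toReal := fun t ht => by
    have hnonneg := (hb t ht).mono fun ω hω => hω.1
    rw [integral_eq_lintegral_of_nonneg_ae hnonneg (hΔ t ht).aestronglyMeasurable,
      lintegral_eq_lintegral_meas_le P hnonneg (hΔ t ht)]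
  have hlim : Tendsto (fun t => ∫⁻ a in Set.Ioi 0, P {ω | a ≤ Δ t ω}) atTop
      (𝓝 (∫⁻ a in Set.Ioi 0, κ a)) := by
    refine tendsto_lintegral_filter_of_dominated_convergence
      (fun a => (Set.Iic a₀).indicator 1 a + (Set.Ioi 0).indicator κ (a - a₀))
      (.of_forall fun t => (hanti t).measurable) ?_ ?_ ?_
    · filter_upwards [eventually_ge_atTop 0] with t ht
      exact ae_of_all _ (measure_le_age_le ha₀ ((hb t ht).mono fun _ => And.right) (htail t))
    · refine ne_top_of_le_ne_top ?_ setLIntegral_indicator_add_indicator_sub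
      simp [hκm]
    · filter_upwards [ae_restrict_mem measurableSet_Ioi] with a ha
      exact tendsto_const_nhds.congr'
        ((eventually_ge_atTop a).mono fun t hat => (htail t a ha hat).symm)
  rw [hκm] at hlim
  have hreal := (ENNReal.tendsto_toReal ENNReal.ofReal_ne_top).comp hlim
  rw [ENNReal.toReal_ofReal hm] at hreal
  exact hreal.congr' ((eventually_ge_atTop 0).mono fun t ht => (hlayer t ht).symm)

lemma IsAverageAge.of_hasLaw {Ω' : Type*} [MeasurableSpace Ω'] {Q : Measure Ω'} {Y : Ω → Ω'}
    (hY : HasLaw Y Q P) {Δ : ℝ → Ω' → ℝ} {a : ℝ} (h : IsAverageAge Q Δ a) :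
    IsAverageAge P (fun t ω => Δ t (Y ω)) a := by
  refine ⟨fun t ht => ?_, h.2.congr' ?_⟩
  · have hint := h.1 t ht
    rw [← hY.map_eq] at hint
    exact hint.comp_aemeasurable hY.aemeasurable
  · filter_upwards [eventually_ge_atTop 0] with t ht
    exact (hY.integral_comp (h.1 t ht).aestronglyMeasurable).symm

end Averages

section MonitorAge

variable {a₀ : ℝ} {gen : ℕ → ℝ} {delivered : ℕ → Prop} {t : ℝ}

lemma le_monitorAge_iff (hgen : ∀ k, delivered k → gen k ≤ t) {a : ℝ} :
    a ≤ monitorAge a₀ gen delivered t ↔ a ≤ t + a₀ ∧ ∀ k, delivered k → gen k ≤ t - a := by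
  have hbdd : BddAbove (insert (-a₀) (gen '' {k | delivered k})) :=
    BddAbove.insert _ ⟨t, Set.forall_mem_image.2 hgen⟩
  rw [monitorAge, le_sub_comm, csSup_le_iff hbdd (Set.insert_nonempty _ _),
    Set.forall_mem_insert, Set.forall_mem_image, neg_le_sub_iff_le_add]
  rfl

lemma monitorAge_le (hgen : ∀ k, delivered k → gen k ≤ t) :
    monitorAge a₀ gen delivered t ≤ t + a₀ :=
  ((le_monitorAge_iff hgen).1 le_rfl).1

lemma monitorAge_nonneg (ha₀ : 0 ≤ t + a₀) (hgen : ∀ k, delivered k → gen k ≤ t) :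
    0 ≤ monitorAge a₀ gen delivered t :=
  (le_monitorAge_iff hgen).2 ⟨ha₀, by simpa using hgen⟩

lemma measurable_monitorAge {Z : Type*} [MeasurableSpace Z] {gen : Z → ℕ → ℝ}
    {delivered : Z → ℕ → Prop} (hgen : ∀ k, Measurable fun z => gen z k)
    (hdelivered : ∀ k, MeasurableSet {z | delivered z k}) (a₀ t : ℝ) :
    Measurable fun z => monitorAge a₀ (gen z) (delivered z) t := by
  classical
  have hrange : ∀ z, insert (-a₀) (gen z '' {k | delivered z k}) =
      Set.range fun o : Option ℕ =>
        o.elim (-a₀) fun k => if delivered z k then gen z k else -a₀ := fun z => by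
    ext b
    simp only [Set.mem_insert_iff, Set.mem_image, Set.mem_range, Option.exists, Option.elim]
    refine ⟨?_, ?_⟩
    · rintro (rfl | ⟨k, hk, rfl⟩)
      exacts [.inl rfl, .inr ⟨k, if_pos hk⟩]
    · rintro (rfl | ⟨k, rfl⟩)
      · exact .inl rfl
      · split_ifs with hk
        exacts [.inr ⟨k, hk, rfl⟩, .inl rfl]
  simp only [monitorAge, hrange]
  refine measurable_const.sub (Measurable.iSup fun o => ?_)
  cases o with
  | none => exact measurable_const
  | some k => exact Measurable.ite (hdelivered k) (hgen k) measurable_const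

end MonitorAge

section Ages

lemma Start.age₂_nonneg (I : Start) : 0 ≤ I.age₂ := I.age₁_nonneg.trans I.age₁_le_age₂

lemma Start.monitorAge_nonneg (I : Start) : 0 ≤ I.monitorAge :=
  I.age₂_nonneg.trans I.age₂_le_monitorAge

lemma lineGenTime_le_arrivalTime (I : Start) (x : ℕ → ℝ) (k : ℕ) :
    lineGenTime I x k ≤ arrivalTime x k := by
  cases k with
  | zero => simpa [lineGenTime, arrivalTime_zero] using I.age₂_nonneg
  | succ k => exact le_rfl

lemma genTime_le_arrivalTime (I : Start) {x : ℕ → ℝ} (hx : ∀ k, 0 ≤ x k) (k : ℕ) :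
    genTime I x k ≤ arrivalTime x k := by
  match k with
  | 0 => simpa [genTime, arrivalTime_zero] using I.age₂_nonneg
  | 1 => exact (neg_nonpos.2 I.age₁_nonneg).trans (arrivalTime_nonneg hx 1)
  | k + 2 => exact arrivalTime_mono hx (Nat.le_succ _)

lemma lineGenTime_le_of_delivered (I : Start) {z : SamplePath} (hz : z.Nonneg) {t : ℝ} (k : ℕ)
    (hk : Enters I.state k ∧ arrivalTime z.x k + z.s k ≤ arrivalTime z.x (k + 1) ∧
      arrivalTime z.x k + z.s k ≤ t) : lineGenTime I z.x k ≤ t :=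
  (lineGenTime_le_arrivalTime I z.x k).trans
    ((le_add_of_nonneg_right (hz.2 k)).trans hk.2.2)

lemma genTime_le_of_delivered (I : Start) {z : SamplePath} (hz : z.Nonneg) {t : ℝ} (k : ℕ)
    (hk : Accepted I.state z.x z.s k ∧ arrivalTime z.x k + z.s k ≤ t) : genTime I z.x k ≤ t :=
  (genTime_le_arrivalTime I hz.1 k).trans ((le_add_of_nonneg_right (hz.2 k)).trans hk.2)

lemma le_ageMM1Star_iff (I : Start) {z : SamplePath} (hz : z.Nonneg) {t a : ℝ} (hat : a ≤ t) :
    a ≤ ageMM1Star I z.x z.s t ↔ z ∈ preempting.noFresh (t - a) t := by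
  have ha : a ≤ t + I.monitorAge := hat.trans (le_add_of_nonneg_right I.monitorAge_nonneg)
  have hold : -I.age₂ ≤ t - a := (neg_nonpos.2 I.age₂_nonneg).trans (sub_nonneg.2 hat)
  have hzero : ¬ t - a < arrivalTime z.x 0 := by
    simpa [arrivalTime_zero] using hat
  rw [ageMM1Star, le_monitorAge_iff (lineGenTime_le_of_delivered I hz)]
  simp only [ha, true_and, Discipline.noFresh, preempting, Set.mem_ofPred_eq]
  rw [← Nat.and_forall_add_one, ← Nat.and_forall_add_one (p := fun k => t - a < _ → _)]
  simp only [hold, hzero, implies_true, false_imp_iff, true_and, Enters, lineGenTime]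
  exact forall_congr' fun k =>
    ⟨fun h hfresh hdel => not_le.1 fun ht => (h ⟨hdel, ht⟩).not_gt hfresh,
      fun h hdel => not_lt.1 fun hfresh => (h hfresh hdel.1).not_ge hdel.2⟩

lemma le_ageMM11_iff (I : Start) {z : SamplePath} (hz : z.Nonneg) {t a : ℝ} (hat : a ≤ t) :
    a ≤ ageMM11 I z.x z.s t ↔ ∀ k, t - a < arrivalTime z.x (k + 1) →
      Accepted I.state z.x z.s (k + 2) → t < arrivalTime z.x (k + 2) + z.s (k + 2) := by
  have ha : a ≤ t + I.monitorAge := hat.trans (le_add_of_nonneg_right I.monitorAge_nonneg)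
  have hold₀ : -I.age₂ ≤ t - a := (neg_nonpos.2 I.age₂_nonneg).trans (sub_nonneg.2 hat)
  have hold₁ : -I.age₁ ≤ t - a := (neg_nonpos.2 I.age₁_nonneg).trans (sub_nonneg.2 hat)
  rw [ageMM11, le_monitorAge_iff (genTime_le_of_delivered I hz)]
  simp only [ha, true_and]
  rw [← Nat.and_forall_add_one,
    ← Nat.and_forall_add_one (p := fun k => _ → genTime I z.x (k + 1) ≤ _)]
  simp only [zero_add, hold₀, hold₁, implies_true, true_and, genTime]
  exact forall_congr' fun k =>
    ⟨fun h hfresh hdel => not_le.1 fun ht => (h ⟨hdel, ht⟩).not_gt hfresh,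
      fun h hdel => not_lt.1 fun hfresh => (h hfresh hdel.1).not_ge hdel.2⟩

lemma le_ageMM11_busy_iff (I : Start) (hI : I.state = 1) {z : SamplePath} (hz : z.Nonneg)
    {t a : ℝ} (hat : a ≤ t) :
    a ≤ ageMM11 I z.x z.s t ↔ z ∈ blocking.noFresh (t - a) t := by
  have hzero : ¬ t - a < arrivalTime z.x 0 := by
    simpa [arrivalTime_zero] using hat
  rw [le_ageMM11_iff I hz hat, hI]
  simp only [Discipline.noFresh, blocking, Set.mem_ofPred_eq]
  rw [← Nat.and_forall_add_one (p := fun k => t - a < arrivalTime z.x k → _)]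
  simp only [hzero, false_imp_iff, true_and]

lemma le_ageMM11_idle_iff (I : Start) (hI : I.state = 0) {z : SamplePath} (hz : z.Nonneg)
    {t a : ℝ} (hat : a ≤ t) :
    a ≤ ageMM11 I z.x z.s t ↔
      z.tail ∈ blocking.noFresh (t - a - z.x 0) (t - z.x 0) := by
  rw [le_ageMM11_iff I hz hat, hI]
  have harrival : ∀ k, arrivalTime z.x (k + 1) = z.x 0 + arrivalTime z.tail.x k :=
    arrivalTime_succ z.x
  have haccepted : ∀ k, Accepted 0 z.x z.s (k + 2) ↔ Accepted 1 z.tail.x z.tail.s (k + 1) :=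
    fun k => by
      simp only [Accepted, freeTime_idle_succ (hz.1 0), harrival (k + 1), add_le_add_iff_left]
  refine forall_congr' fun k => ?_
  rw [haccepted, harrival, harrival, add_assoc, ← sub_lt_iff_lt_add', ← sub_lt_iff_lt_add']
  rfl

lemma measurable_ageMM1Star (I : Start) (t : ℝ) :
    Measurable fun z : SamplePath => ageMM1Star I z.x z.s t := by
  refine measurable_monitorAge (gen := fun z : SamplePath => lineGenTime I z.x)
    (delivered := fun z k => Enters I.state k ∧
      arrivalTime z.x k + z.s k ≤ arrivalTime z.x (k + 1) ∧ arrivalTime z.x k + z.s k ≤ t)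
    (fun k => ?_) (fun k => ?_) _ t
  · cases k with
    | zero => exact measurable_const
    | succ k =>
      simp only [lineGenTime]
      fun_prop
  · have hdone : MeasurableSet {z : SamplePath | arrivalTime z.x k + z.s k ≤ t} :=
      measurableSet_le (by fun_prop) measurable_const
    exact (MeasurableSet.const _).inter ((preempting.measurableSet_delivered k).inter hdone)

lemma measurable_ageMM11 (I : Start) (t : ℝ) :
    Measurable fun z : SamplePath => ageMM11 I z.x z.s t := by
  refine measurable_monitorAge (gen := fun z : SamplePath => genTime I z.x)
    (delivered := fun z k => Accepted I.state z.x z.s k ∧ arrivalTime z.x k + z.s k ≤ t)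
    (fun k => ?_) (fun k => ?_) _ t
  · match k with
    | 0 => exact measurable_const
    | 1 => exact measurable_const
    | k + 2 =>
      simp only [genTime]
      fun_prop
  · have hdone : MeasurableSet {z : SamplePath | arrivalTime z.x k + z.s k ≤ t} :=
      measurableSet_le (by fun_prop) measurable_const
    exact (measurableSet_accepted _ k).inter hdone

variable {μ₁ μ₂ : ℝ}

lemma lintegral_ageTail_preempting (hμ₁ : 0 < μ₁) (hμ₂ : 0 < μ₂) :
    ∫⁻ a in Set.Ioi 0, preempting.ageTail (expMeasure μ₁) (expMeasure μ₂) a =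
      ENNReal.ofReal (1 / μ₁ + 1 / μ₂) := by
  have := isProbabilityMeasure_expMeasure hμ₁
  have := isProbabilityMeasure_expMeasure hμ₂
  rw [Discipline.lintegral_ageTail (ae_expMeasure_nonneg hμ₁) (ae_expMeasure_nonneg hμ₂),
    lintegral_ofReal_expMeasure hμ₁, lintegral_delay_preempting hμ₁ hμ₂,
    ENNReal.ofReal_add (by positivity) (by positivity)]

lemma lintegral_ageTail_blocking (hμ₁ : 0 < μ₁) (hμ₂ : 0 < μ₂) :
    ∫⁻ a in Set.Ioi 0, blocking.ageTail (expMeasure μ₁) (expMeasure μ₂) a =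
      ENNReal.ofReal (2 * (1 / μ₁ + 1 / μ₂)) := by
  have := isProbabilityMeasure_expMeasure hμ₁
  have := isProbabilityMeasure_expMeasure hμ₂
  rw [Discipline.lintegral_ageTail (ae_expMeasure_nonneg hμ₁) (ae_expMeasure_nonneg hμ₂),
    lintegral_ofReal_expMeasure hμ₁, lintegral_delay_blocking hμ₁ hμ₂,
    ← ENNReal.ofReal_add (by positivity) (by positivity)]
  ring_nf

lemma measure_le_ageMM11 (hμ₁ : 0 < μ₁) (hμ₂ : 0 < μ₂) (I : Start) {t a : ℝ} (hat : a ≤ t) :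
    pathMeasure (expMeasure μ₁) (expMeasure μ₂) {z | a ≤ ageMM11 I z.x z.s t} =
      blocking.ageTail (expMeasure μ₁) (expMeasure μ₂) a := by
  have := isProbabilityMeasure_expMeasure hμ₁
  have := isProbabilityMeasure_expMeasure hμ₂
  have hν₂ := ae_expMeasure_nonneg hμ₂
  have hnonneg := SamplePath.ae_nonneg (ae_expMeasure_nonneg hμ₁) hν₂
  have hstate : I.state = 0 ∨ I.state = 1 := by lia
  rcases hstate with hidle | hbusy
  · rw [← Discipline.measure_next_mem_noFresh_eq_ageTail hμ₁ hν₂ (regenerates_blocking hμ₁ hμ₂)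
      regenerates_tail (sub_nonneg.2 hat), sub_add_cancel]
    exact measure_congr (hnonneg.mono fun z hz => propext (le_ageMM11_idle_iff I hidle hz hat))
  · rw [← Discipline.measure_noFresh hμ₁ hν₂ (regenerates_blocking hμ₁ hμ₂) (sub_nonneg.2 hat),
      sub_add_cancel]
    exact measure_congr (hnonneg.mono fun z hz => propext (le_ageMM11_busy_iff I hbusy hz hat))

lemma measure_le_ageMM1Star (hμ₁ : 0 < μ₁) (hμ₂ : 0 < μ₂) (I : Start) {t a : ℝ} (hat : a ≤ t) :
    pathMeasure (expMeasure μ₁) (expMeasure μ₂) {z | a ≤ ageMM1Star I z.x z.s t} =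
      preempting.ageTail (expMeasure μ₁) (expMeasure μ₂) a := by
  have := isProbabilityMeasure_expMeasure hμ₁
  have := isProbabilityMeasure_expMeasure hμ₂
  have hν₂ := ae_expMeasure_nonneg hμ₂
  have hnonneg := SamplePath.ae_nonneg (ae_expMeasure_nonneg hμ₁) hν₂
  rw [← Discipline.measure_noFresh hμ₁ hν₂ regenerates_preempting (sub_nonneg.2 hat),
    sub_add_cancel]
  exact measure_congr (hnonneg.mono fun z hz => propext (le_ageMM1Star_iff I hz hat))

lemma isAverageAge_ageMM1Star (hμ₁ : 0 < μ₁) (hμ₂ : 0 < μ₂) (I : Start) :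
    IsAverageAge (pathMeasure (expMeasure μ₁) (expMeasure μ₂))
      (fun t z => ageMM1Star I z.x z.s t) (1 / μ₁ + 1 / μ₂) := by
  have := isProbabilityMeasure_expMeasure hμ₁
  have := isProbabilityMeasure_expMeasure hμ₂
  have hnonneg := SamplePath.ae_nonneg (ae_expMeasure_nonneg hμ₁) (ae_expMeasure_nonneg hμ₂)
  refine isAverageAge_of_tail I.monitorAge_nonneg (by positivity)
    (fun t _ => (measurable_ageMM1Star I t).aemeasurable) (fun t ht => ?_)
    (fun t a _ hat => measure_le_ageMM1Star hμ₁ hμ₂ I hat) (lintegral_ageTail_preempting hμ₁ hμ₂)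
  filter_upwards [hnonneg] with z hz
  have hgen := lineGenTime_le_of_delivered I hz (t := t)
  exact ⟨monitorAge_nonneg (add_nonneg ht I.monitorAge_nonneg) hgen, monitorAge_le hgen⟩

lemma isAverageAge_ageMM11 (hμ₁ : 0 < μ₁) (hμ₂ : 0 < μ₂) (I : Start) :
    IsAverageAge (pathMeasure (expMeasure μ₁) (expMeasure μ₂))
      (fun t z => ageMM11 I z.x z.s t) (2 * (1 / μ₁ + 1 / μ₂)) := by
  have := isProbabilityMeasure_expMeasure hμ₁
  have := isProbabilityMeasure_expMeasure hμ₂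
  have hnonneg := SamplePath.ae_nonneg (ae_expMeasure_nonneg hμ₁) (ae_expMeasure_nonneg hμ₂)
  refine isAverageAge_of_tail I.monitorAge_nonneg (by positivity)
    (fun t _ => (measurable_ageMM11 I t).aemeasurable) (fun t ht => ?_)
    (fun t a _ hat => measure_le_ageMM11 hμ₁ hμ₂ I hat) (lintegral_ageTail_blocking hμ₁ hμ₂)
  filter_upwards [hnonneg] with z hz
  have hgen := genTime_le_of_delivered I hz (t := t)
  exact ⟨monitorAge_nonneg (add_nonneg ht I.monitorAge_nonneg) hgen, monitorAge_le hgen⟩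

end Ages

/-! ### Stationary distribution -/

lemma stateMM11_eq_one_iff {x : ℕ → ℝ} (hx : ∀ k, 0 ≤ x k) (q : ServerState) (s : ℕ → ℝ) (t : ℝ) :
    stateMM11 q x s t = 1 ↔ ∃ k, arrivalTime x k ≤ t ∧ t < freeTime q x s k := by
  have hiff : (∃ k, Accepted q x s k ∧ arrivalTime x k ≤ t ∧ t < arrivalTime x k + s k) ↔
      ∃ k, arrivalTime x k ≤ t ∧ t < freeTime q x s k := by
    constructor
    · rintro ⟨k, hacc, harrived, hbusy⟩
      exact ⟨k, harrived, by rwa [freeTime_of_accepted hacc]⟩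
    · rintro ⟨k, harrived, hbusy⟩
      by_cases hacc : Accepted q x s k
      · exact ⟨k, hacc, harrived, by rwa [← freeTime_of_accepted hacc]⟩
      induction k with
      | zero =>
        rw [freeTime, if_neg (show ¬q = 1 from hacc)] at hbusy
        rw [arrivalTime_zero] at harrived
        exact absurd harrived hbusy.not_ge
      | succ k ih =>
        rw [freeTime_succ, if_neg (show ¬_ ≤ _ from hacc)] at hbusy
        have harrived' := (arrivalTime_mono hx k.le_succ).trans harrived
        by_cases hacc' : Accepted q x s k
        · exact ⟨k, hacc', harrived', by rwa [← freeTime_of_accepted hacc']⟩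
        · exact ih harrived' hbusy hacc'
  rw [← hiff, stateMM11]
  split_ifs with h <;> simp [h]

lemma measurableSet_stateMM11_eq_one (q : ServerState) :
    MeasurableSet {p : ℝ × SamplePath | stateMM11 q p.2.x p.2.s p.1 = 1} := by
  have hUnion : {p : ℝ × SamplePath | stateMM11 q p.2.x p.2.s p.1 = 1} =
      ⋃ k, {p | Accepted q p.2.x p.2.s k} ∩
        ({p | arrivalTime p.2.x k ≤ p.1} ∩ {p | p.1 < arrivalTime p.2.x k + p.2.s k}) := by
    ext p
    simp only [Set.mem_ofPred_eq, Set.mem_iUnion, Set.mem_inter_iff, stateMM11]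
    split_ifs with h <;> simp [h]
  rw [hUnion]
  exact MeasurableSet.iUnion fun k =>
    ((measurableSet_accepted q k).preimage measurable_snd).inter
      ((measurableSet_le (by fun_prop) (by fun_prop)).inter
        (measurableSet_lt (by fun_prop) (by fun_prop)))

/-- The event that server 2 is busy at time `t`, if it is in state `q` at time `0`. -/
def busyAt (q : ServerState) (t : ℝ) : Set SamplePath := {z | stateMM11 q z.x z.s t = 1}

lemma measurableSet_busyAt (q : ServerState) (t : ℝ) : MeasurableSet (busyAt q t) :=
  measurable_prodMk_left (measurableSet_stateMM11_eq_one q)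

lemma mem_busyAt_iff {z : SamplePath} (hz : z.Nonneg) {q : ServerState} {t : ℝ} :
    z ∈ busyAt q t ↔ ∃ k, arrivalTime z.x k ≤ t ∧ t < freeTime q z.x z.s k :=
  stateMM11_eq_one_iff hz.1 q z.s t

lemma mem_busyAt_zero_iff {z : SamplePath} (hz : z.Nonneg) (htail : z.tail.Nonneg) {t : ℝ} :
    z ∈ busyAt 0 t ↔ z.x 0 ≤ t ∧ z.tail ∈ busyAt 1 (t - z.x 0) := by
  have hle : z.tail ∈ busyAt 1 (t - z.x 0) → z.x 0 ≤ t := by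
    rw [mem_busyAt_iff htail]
    rintro ⟨k, harrived, -⟩
    exact sub_nonneg.1 ((arrivalTime_nonneg htail.1 k).trans harrived)
  rw [and_iff_right_of_imp hle, mem_busyAt_iff hz, mem_busyAt_iff htail, ← Nat.or_exists_add_one]
  rw [or_iff_right (fun hzero => by
    simpa [freeTime, arrivalTime] using hzero.1.trans_lt hzero.2)]
  refine exists_congr fun k => ?_
  rw [freeTime_idle_succ (hz.1 0), arrivalTime_succ, le_sub_iff_add_le', sub_lt_iff_lt_add']
  rfl

lemma mem_busyAt_one_iff {z : SamplePath} (hz : z.Nonneg) (hnext : z.nextBlock.Nonneg) {t : ℝ}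
    (ht : 0 ≤ t) :
    z ∈ busyAt 1 t ↔
      t < min (z.x 0) (z.s 0) ∨ z.x 0 ≤ t ∧ z.nextBlock ∈ busyAt 1 (t - z.x 0) := by
  have hiff : z ∈ busyAt 1 t ↔ t < z.s 0 ∨ z.nextBlock ∈ busyAt 1 (t - z.x 0) := by
    rw [mem_busyAt_iff hz, mem_busyAt_iff hnext, ← Nat.or_exists_add_one]
    refine or_congr (by simp [freeTime, arrivalTime, ht]) (exists_congr fun k => ?_)
    rw [freeTime_busy_succ, arrivalTime_succ, le_sub_iff_add_le', sub_lt_iff_lt_add']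
    simp only [← SamplePath.x_nextBlock]
  have hle : z.nextBlock ∈ busyAt 1 (t - z.x 0) → z.x 0 ≤ t := by
    rw [mem_busyAt_iff hnext]
    rintro ⟨k, harrived, -⟩
    exact sub_nonneg.1 ((arrivalTime_nonneg hnext.1 k).trans harrived)
  have hstill : z.x 0 ≤ t → t < z.s 0 → z.nextBlock ∈ busyAt 1 (t - z.x 0) := by
    intro hxt hts
    refine (mem_busyAt_iff hnext).2 ⟨0, by simpa [arrivalTime] using hxt, ?_⟩
    simpa [freeTime, SamplePath.s_nextBlock_zero, (hxt.trans_lt hts).not_ge] using hts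
  have hsplit := lt_or_ge t (z.x 0)
  rw [hiff, lt_min_iff]
  tauto

lemma measure_next_mem_busyAt {ν₁ ν₂ : Measure ℝ} [IsProbabilityMeasure ν₁]
    [IsProbabilityMeasure ν₂] {next : SamplePath → SamplePath} (hnext : Regenerates ν₁ ν₂ next)
    (q : ServerState) (t : ℝ) :
    pathMeasure ν₁ ν₂ {z | z.x 0 ≤ t ∧ next z ∈ busyAt q (t - z.x 0)} =
      ∫⁻ y in Set.Iic t, pathMeasure ν₁ ν₂ (busyAt q (t - y)) ∂ν₁ := by
  have hmeas : MeasurableSet {p : ℝ × SamplePath | p.1 ≤ t ∧ p.2 ∈ busyAt q (t - p.1)} :=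
    (measurableSet_le measurable_fst measurable_const).inter
      ((measurableSet_stateMM11_eq_one q).preimage
        (f := fun p : ℝ × SamplePath => (t - p.1, p.2)) (by fun_prop))
  rw [← lintegral_indicator measurableSet_Iic]
  refine (hnext.measure_x_next hmeas).trans (lintegral_congr fun y => ?_)
  by_cases hy : y ≤ t <;> simp [hy]

/-- The probability that server 2 is busy at time `t`, if it is busy with probability `p` at
time `0`. -/
noncomputable def busyProb (μ₁ μ₂ p t : ℝ) : ℝ :=
  μ₁ / (μ₁ + μ₂) + (p - μ₁ / (μ₁ + μ₂)) * Real.exp (-((μ₁ + μ₂) * t))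

section BusyProb

variable {μ₁ μ₂ p t : ℝ}

lemma busyProb_mem_Icc (hμ₁ : 0 < μ₁) (hμ₂ : 0 < μ₂) (hp : p ∈ Set.Icc 0 1) (ht : 0 ≤ t) :
    busyProb μ₁ μ₂ p t ∈ Set.Icc 0 1 := by
  have hratio : μ₁ / (μ₁ + μ₂) ∈ Set.Icc 0 1 :=
    ⟨by positivity, (div_le_one (by positivity)).2 (by linarith)⟩
  have hexp : Real.exp (-((μ₁ + μ₂) * t)) ≤ 1 :=
    Real.exp_le_one_iff.2 (neg_nonpos.2 (by positivity))
  have hconvex := convex_Icc (0 : ℝ) 1 hratio hp (sub_nonneg.2 hexp) (Real.exp_pos _).le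
    (sub_add_cancel _ _)
  convert hconvex using 1
  simp only [busyProb, smul_eq_mul]
  ring

lemma continuous_busyProb : Continuous (busyProb μ₁ μ₂ p) := by
  unfold busyProb
  fun_prop

lemma busyProb_one_eq_add : busyProb μ₁ μ₂ 1 t =
    Real.exp (-((μ₁ + μ₂) * t)) + busyProb μ₁ μ₂ 0 t := by
  unfold busyProb
  ring

lemma busyProb_eq_mix : busyProb μ₁ μ₂ p t =
    (1 - p) * busyProb μ₁ μ₂ 0 t + p * busyProb μ₁ μ₂ 1 t := by
  unfold busyProb
  ring

lemma busyProb_stationary : busyProb μ₁ μ₂ (μ₁ / (μ₁ + μ₂)) t = μ₁ / (μ₁ + μ₂) := by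
  simp [busyProb]

lemma eq_of_busyProb_eq_self (hμ : 0 < μ₁ + μ₂) (ht : 0 < t) (h : busyProb μ₁ μ₂ p t = p) :
    p = μ₁ / (μ₁ + μ₂) := by
  have hexp : Real.exp (-((μ₁ + μ₂) * t)) < 1 :=
    Real.exp_lt_one_iff.2 (neg_lt_zero.2 (by positivity))
  have hprod : (p - μ₁ / (μ₁ + μ₂)) * (1 - Real.exp (-((μ₁ + μ₂) * t))) = 0 := by
    unfold busyProb at h
    linear_combination -h
  exact sub_eq_zero.1 ((mul_eq_zero.1 hprod).resolve_right (sub_pos.2 hexp).ne')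

lemma integral_exp_mul_busyProb (hμ : μ₁ + μ₂ ≠ 0) :
    ∫ y in (0)..t, μ₁ * Real.exp (-(μ₁ * y)) * busyProb μ₁ μ₂ 1 (t - y) =
      busyProb μ₁ μ₂ 0 t := by
  have hderiv : ∀ y, HasDerivAt (fun y => μ₁ / (μ₁ + μ₂) *
      (Real.exp (μ₂ * y - (μ₁ + μ₂) * t) - Real.exp (-(μ₁ * y))))
      (μ₁ * Real.exp (-(μ₁ * y)) * busyProb μ₁ μ₂ 1 (t - y)) y := by
    intro y
    have hleft : HasDerivAt (fun y => Real.exp (μ₂ * y - (μ₁ + μ₂) * t))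
        (Real.exp (μ₂ * y - (μ₁ + μ₂) * t) * μ₂) y := by
      simpa using (((hasDerivAt_id y).const_mul μ₂).sub_const _).exp
    have hright : HasDerivAt (fun y => Real.exp (-(μ₁ * y))) (Real.exp (-(μ₁ * y)) * -μ₁) y := by
      simpa using ((hasDerivAt_id y).const_mul μ₁).neg.exp
    refine ((hleft.sub hright).const_mul (μ₁ / (μ₁ + μ₂))).congr_deriv ?_
    have hexp : Real.exp (μ₂ * y - (μ₁ + μ₂) * t) =
        Real.exp (-(μ₁ * y)) * Real.exp (-((μ₁ + μ₂) * (t - y))) := by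
      rw [← Real.exp_add]
      ring_nf
    rw [hexp, busyProb]
    field_simp
    ring
  have hcont : Continuous fun y => μ₁ * Real.exp (-(μ₁ * y)) * busyProb μ₁ μ₂ 1 (t - y) :=
    (by fun_prop : Continuous fun y => μ₁ * Real.exp (-(μ₁ * y))).mul
      (continuous_busyProb.comp (by fun_prop))
  rw [intervalIntegral.integral_eq_sub_of_hasDerivAt (fun y _ => hderiv y)
    (hcont.intervalIntegrable _ _)]
  simp only [busyProb, mul_zero, neg_zero, Real.exp_zero, zero_sub]
  ring_nf

lemma setLIntegral_Iic_busyProb (hμ₁ : 0 < μ₁) (hμ₂ : 0 < μ₂) (ht : 0 ≤ t) :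
    ∫⁻ y in Set.Iic t, ENNReal.ofReal (busyProb μ₁ μ₂ 1 (t - y)) ∂(expMeasure μ₁) =
      ENNReal.ofReal (busyProb μ₁ μ₂ 0 t) := by
  rw [← integral_exp_mul_busyProb (by positivity)]
  exact setLIntegral_Iic_ofReal_expMeasure hμ₁.le ht (continuous_busyProb.comp (by fun_prop))
    fun y hy => (busyProb_mem_Icc hμ₁ hμ₂ ⟨zero_le_one, le_rfl⟩ (sub_nonneg.2 hy)).1

lemma measure_busyAt_one (hμ₁ : 0 < μ₁) (hμ₂ : 0 < μ₂) (ht : 0 ≤ t) :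
    pathMeasure (expMeasure μ₁) (expMeasure μ₂) (busyAt 1 t) =
      ENNReal.ofReal (busyProb μ₁ μ₂ 1 t) := by
  have := isProbabilityMeasure_expMeasure hμ₁
  have := isProbabilityMeasure_expMeasure hμ₂
  have hnext := regenerates_nextBlock hμ₂ (ae_expMeasure_nonneg hμ₁)
  refine renewal_unique (φ := fun t => pathMeasure (expMeasure μ₁) (expMeasure μ₂) (busyAt 1 t))
    (g := fun t => ENNReal.ofReal (Real.exp (-((μ₁ + μ₂) * t)))) (ae_expMeasure_nonneg hμ₁)
    (fun t => expMeasure_Iic_lt_one hμ₁) (fun t _ => prob_le_one)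
    (fun t ht => ENNReal.ofReal_le_one.2
      (busyProb_mem_Icc hμ₁ hμ₂ ⟨zero_le_one, le_rfl⟩ ht).2) (fun t ht => ?_) (fun t ht => ?_) ht
  · have hmeas : MeasurableSet {z : SamplePath | t < min (z.x 0) (z.s 0)} :=
      measurableSet_lt (by fun_prop) (by fun_prop)
    rw [← measure_next_mem_busyAt hnext, ← measure_lt_min_x_s hμ₁ hμ₂ ht,
      ← measure_union' (Set.disjoint_left.2 fun z hlt hle =>
        hle.1.not_gt (lt_min_iff.1 hlt).1) hmeas]
    have hnonneg := SamplePath.ae_nonneg (ae_expMeasure_nonneg hμ₁) (ae_expMeasure_nonneg hμ₂)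
    refine measure_congr ?_
    filter_upwards [hnonneg, hnext.ae_nonneg hnonneg] with z hz hz'
    exact propext (mem_busyAt_one_iff hz hz' ht)
  · rw [setLIntegral_Iic_busyProb hμ₁ hμ₂ ht, busyProb_one_eq_add,
      ENNReal.ofReal_add (Real.exp_pos _).le
        (busyProb_mem_Icc hμ₁ hμ₂ ⟨le_rfl, zero_le_one⟩ ht).1]

lemma measure_busyAt_zero (hμ₁ : 0 < μ₁) (hμ₂ : 0 < μ₂) (ht : 0 ≤ t) :
    pathMeasure (expMeasure μ₁) (expMeasure μ₂) (busyAt 0 t) =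
      ENNReal.ofReal (busyProb μ₁ μ₂ 0 t) := by
  have := isProbabilityMeasure_expMeasure hμ₁
  have := isProbabilityMeasure_expMeasure hμ₂
  have hnext : Regenerates (expMeasure μ₁) (expMeasure μ₂) SamplePath.tail := regenerates_tail
  have hnonneg := SamplePath.ae_nonneg (ae_expMeasure_nonneg hμ₁) (ae_expMeasure_nonneg hμ₂)
  calc pathMeasure (expMeasure μ₁) (expMeasure μ₂) (busyAt 0 t)
      = pathMeasure (expMeasure μ₁) (expMeasure μ₂)
          {z | z.x 0 ≤ t ∧ z.tail ∈ busyAt 1 (t - z.x 0)} := by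
        refine measure_congr ?_
        filter_upwards [hnonneg, hnext.ae_nonneg hnonneg] with z hz hz'
        exact propext (mem_busyAt_zero_iff hz hz')
    _ = ∫⁻ y in Set.Iic t, ENNReal.ofReal (busyProb μ₁ μ₂ 1 (t - y)) ∂(expMeasure μ₁) := by
        rw [measure_next_mem_busyAt hnext]
        exact setLIntegral_congr_fun measurableSet_Iic fun y hy =>
          measure_busyAt_one hμ₁ hμ₂ (sub_nonneg.2 hy)
    _ = ENNReal.ofReal (busyProb μ₁ μ₂ 0 t) := setLIntegral_Iic_busyProb hμ₁ hμ₂ ht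

end BusyProb

section Stationary

variable {Ω : Type*} [MeasurableSpace Ω] {P : Measure Ω} {μ₁ μ₂ : ℝ} {X S : ℕ → Ω → ℝ}

lemma transProb_busy (hμ₁ : 0 < μ₁) (hμ₂ : 0 < μ₂) (h : ExpServices P μ₁ μ₂ X S) (t : ℝ)
    (i : ServerState) :
    transProb P X S t i 1 =
      (pathMeasure (expMeasure μ₁) (expMeasure μ₂)).real (busyAt i t) :=
  (h.hasLaw_pathMeasure hμ₁ hμ₂).measureReal_eq (measurableSet_busyAt i t)

lemma transProb_idle (hμ₁ : 0 < μ₁) (hμ₂ : 0 < μ₂) (h : ExpServices P μ₁ μ₂ X S) (t : ℝ)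
    (i : ServerState) : transProb P X S t i 0 = 1 - transProb P X S t i 1 := by
  have := isProbabilityMeasure_expMeasure hμ₁
  have := isProbabilityMeasure_expMeasure hμ₂
  have hcompl : {z : SamplePath | stateMM11 i z.x z.s t = 0} = (busyAt i t)ᶜ := by
    ext z
    simp only [busyAt, Set.mem_compl_iff, Set.mem_ofPred_eq]
    exact (by decide : ∀ q : ServerState, q = 0 ↔ ¬q = 1) _
  rw [transProb_busy hμ₁ hμ₂ h, ← probReal_compl_eq_one_sub (measurableSet_busyAt i t), ← hcompl]
  exact (h.hasLaw_pathMeasure hμ₁ hμ₂).measureReal_eq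
    (p := fun z : SamplePath => stateMM11 i z.x z.s t = 0)
    (hcompl ▸ (measurableSet_busyAt i t).compl)

lemma sum_mul_transProb_one (hμ₁ : 0 < μ₁) (hμ₂ : 0 < μ₂) (h : ExpServices P μ₁ μ₂ X S)
    {π : ServerState → ℝ} (hπ : ∑ q, π q = 1) {t : ℝ} (ht : 0 ≤ t) :
    ∑ i, π i * transProb P X S t i 1 = busyProb μ₁ μ₂ (π 1) t := by
  rw [Fin.sum_univ_two] at hπ ⊢
  rw [transProb_busy hμ₁ hμ₂ h, transProb_busy hμ₁ hμ₂ h, measureReal_def, measureReal_def,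
    measure_busyAt_zero hμ₁ hμ₂ ht, measure_busyAt_one hμ₁ hμ₂ ht,
    ENNReal.toReal_ofReal (busyProb_mem_Icc hμ₁ hμ₂ ⟨le_rfl, zero_le_one⟩ ht).1,
    ENNReal.toReal_ofReal (busyProb_mem_Icc hμ₁ hμ₂ ⟨zero_le_one, le_rfl⟩ ht).1,
    busyProb_eq_mix (p := π 1), eq_sub_of_add_eq hπ]

lemma isStationary_iff (hμ₁ : 0 < μ₁) (hμ₂ : 0 < μ₂) (h : ExpServices P μ₁ μ₂ X S)
    {π : ServerState → ℝ} :
    IsStationary (transProb P X S) π ↔ π = ![μ₂ / (μ₁ + μ₂), μ₁ / (μ₁ + μ₂)] := by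
  have hμ : 0 < μ₁ + μ₂ := by positivity
  have hsum : μ₂ / (μ₁ + μ₂) + μ₁ / (μ₁ + μ₂) = 1 := by field_simp; ring
  constructor
  · rintro ⟨-, hπ, hbalance⟩
    have hbusy : π 1 = μ₁ / (μ₁ + μ₂) := eq_of_busyProb_eq_self hμ zero_lt_one
      (by rw [← sum_mul_transProb_one hμ₁ hμ₂ h hπ zero_le_one, hbalance 1 zero_le_one 1])
    have hidle : π 0 = μ₂ / (μ₁ + μ₂) := by
      rw [Fin.sum_univ_two] at hπ
      linarith
    ext i
    fin_cases i
    exacts [hidle, hbusy]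
  · rintro rfl
    have hπ : ∑ q, ![μ₂ / (μ₁ + μ₂), μ₁ / (μ₁ + μ₂)] q = 1 := by simpa using hsum
    have hbusy : ∀ t, 0 ≤ t →
        ∑ i, ![μ₂ / (μ₁ + μ₂), μ₁ / (μ₁ + μ₂)] i * transProb P X S t i 1 = μ₁ / (μ₁ + μ₂) :=
      fun t ht => (sum_mul_transProb_one hμ₁ hμ₂ h hπ ht).trans busyProb_stationary
    refine ⟨Fin.forall_fin_two.2 ⟨(div_pos hμ₂ hμ).le, (div_pos hμ₁ hμ).le⟩, hπ, fun t ht j => ?_⟩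
    fin_cases j
    · simp only [Fin.zero_eta, transProb_idle hμ₁ hμ₂ h, mul_sub, mul_one, Finset.sum_sub_distrib,
        hπ, hbusy t ht]
      exact sub_eq_of_eq_add hsum.symm
    · exact hbusy t ht

end Stationary

lemma activity_eq (α ρ : ℝ) (π : ServerState → ℝ) :
    activity α ρ π = ρ ^ α * (π 0 + π 1) + π 1 := by
  simp [activity, numStep₁, numStep₂, Fin.sum_univ_two]

end Tandem

theorem mainTheorem6 {Ω : Type*} [MeasurableSpace Ω] (P : Measure Ω) [IsProbabilityMeasure P]
    (μ₁ μ₂ ρ α : ℝ) (hμ₁ : 0 < μ₁) (hμ₂ : 0 < μ₂) (hρ : ρ = μ₁ / μ₂)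
    (X S : ℕ → Ω → ℝ) (hXS : Tandem.ExpServices P μ₁ μ₂ X S) :
    (∀ I : Tandem.Start, ∃ Δ₁₁ Δstar : ℝ,
      Tandem.IsAverageAge P
        (fun t ω => Tandem.ageMM11 I (fun n => X n ω) (fun n => S n ω) t) Δ₁₁ ∧
      Tandem.IsAverageAge P
        (fun t ω => Tandem.ageMM1Star I (fun n => X n ω) (fun n => S n ω) t) Δstar ∧
      Δ₁₁ = 2 / μ₂ * (1 + 1 / ρ) ∧
      Δ₁₁ = 2 * Δstar) ∧
    ∃ π : Tandem.ServerState → ℝ,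
      (∀ π', Tandem.IsStationary (Tandem.transProb P X S) π' ↔ π' = π) ∧
      Tandem.activity α ρ π = ρ ^ α + ρ / (1 + ρ) := by
  have hlaw := hXS.hasLaw_pathMeasure hμ₁ hμ₂
  subst hρ
  refine ⟨fun I => ⟨_, _, (Tandem.isAverageAge_ageMM11 hμ₁ hμ₂ I).of_hasLaw hlaw,
    (Tandem.isAverageAge_ageMM1Star hμ₁ hμ₂ I).of_hasLaw hlaw, ?_, rfl⟩,
    _, fun _ => Tandem.isStationary_iff hμ₁ hμ₂ hXS, ?_⟩
  · field_simp
    ring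
  · simp only [Tandem.activity_eq, Matrix.cons_val_zero, Matrix.cons_val_one]
    field_simp
    ring
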